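/- **Setting.** On $I=(0,\infty)$ let $dm=2x^2\,dx$, and let $(\mathcal E,\mathcal D)$ be the Dirichlet form of the three-dimensional Bessel process in $L^2(I,m)$: $$\mathcal D=\Big\{u\in L^2(I,m):\ u \text{ locally absolutely continuous on } I,\ \int_0^\infty u'(x)^2x^2\,dx<\infty\Big\},\qquad \mathcal E[u]=\int_0^\infty u'(x)^2x^2\,dx .$$ For $\lambda>0$ put $\mathcal E_\lambda[u]=\mathcal E[u]+\lambda\int_I u^2\,dm$. Let $N\ge 1$ be an integer, $a_1,\dots,a_N>0$, and $\mu=\sum_{k=1}^N a_k\delta_k$; identify $L^2(\mu)$ with $\mathbb R^N$ through $u\mapsto(u_1,\dots,u_N)=(u(1),\dots,u(N))$. Let $J:\mathcal D\to L^2(\mu)$ be the restriction map $Ju=u|_{\{1,\dots,N\}}$, let $P_\lambda$ be the $\mathcal E_\lambda$-orthogonal projection of $\mathcal D$ onto $(\ker J)^{\perp_{\mathcal E_\lambda}}$, and let $\check{\mathcal E}_\lambda$ be the quadratic form on $L^2(\mu)$ with domain $\operatorname{ran}J$ given by $\check{\mathcal E}_\lambda[Ju]=\mathcal E_\lambda[P_\lambda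 u]$. The trace $\check{\mathcal E}$ of $\mathcal E$ with respect to $\mu$ is the Mosco limit of $\check{\mathcal E}_\lambda$ in $L^2(\mu)$ as $\lambda\downarrow0$, and $\check{\mathcal D}$ is its domain. **Theorem.** The trace $\check{\mathcal E}$ exists, is unique, and is a Dirichlet form on $L^2(\mu)$; moreover: 1. $\check{\mathcal D}=\mathbb R^N$, and for every $u=(u_1,\dots,u_N)\in\mathbb R^N$ $$\check{\mathcal E}[u]=\sum_{k=1}^{N-1}k(k+1)(u_{k+1}-u_k)^2+N\,u_N^2 .$$ Thus $\check{\mathcal E}$ is the sum of a jump Dirichlet form and a killing Dirichlet form, $\check{\mathcal E}[u]=\sum_{k,j=1}^N b(k,j)(u_k-u_j)^2+\sum_{k=1}^N\kappa(k)u_k^2$, with $b(k,j)=kj/2$ if $|k-j|=1$ and $b(k,j)=0$ otherwise, $\kappa(N)=N$ and $\kappa(k)=0$ for $k<N$. 2. $\check{\mathcal E}$ is transient and irreducible. Let $(T_t)_{t\ge0}$ be the semigroup $T_t=e^{-tL}$ on $L^2(\mu)$ associated with $\check{\mathcal E}$, where $L$ is the operator with $\check{\mathcal E}(u,v)=\langle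 Lu,v\rangle_{L^2(\mu)}$. Transience means: there is a bounded $\mu$-integrable $g>0$ with $\int|u|g\,d\mu\le\check{\mathcal E}[u]^{1/2}$ for all $u\in\check{\mathcal D}$; also, for every $0\le f\in L^1(\mu)\cap L^2(\mu)$, $\int_0^\infty T_sf\,ds<\infty$ $\mu$-a.e. Irreducibility means: if a measurable set $A$ satisfies $T_t(\mathbf 1_Af)=\mathbf 1_AT_tf$ for all $t>0$ and $f\in L^2(\mu)$, then $\mu(A)=0$ or $\mu(A^c)=0$. 3. $\check{\mathcal E}$ is not conservative: $T_t1\ne1$ for every $t>0$. -/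

import Mathlib

open MeasureTheory Set Filter Topology
open scoped ENNReal

noncomputable section

/-! ### Quadratic forms, semigroups and Dirichlet forms on `L²(μ)`

A nonnegative quadratic form on a real Hilbert space `H` is represented by a function
`E : H → [0, ∞]`; its domain is the set where it is finite. -/

/-- The domain of an extended-valued quadratic form. -/
def formDomain {H : Type*} (E : H → ℝ≥0∞) : Set H := {u | E u ≠ ∞}

/-- The symmetric bilinear form `E(u, v)` obtained by polarization (for `u`, `v` in the domain). -/
def polarForm {H : Type*} [AddCommGroup H] (E : H → ℝ≥0∞) (u v : H) : ℝ :=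
  ((E (u + v)).toReal - (E (u - v)).toReal) / 4

/-- `E` is a (nonnegative, extended-valued) quadratic form. -/
def IsQuadraticForm {H : Type*} [AddCommGroup H] [Module ℝ H] (E : H → ℝ≥0∞) : Prop :=
  (∀ (c : ℝ) (u : H), E (c • u) = ENNReal.ofReal (c ^ 2) * E u) ∧
  ∀ u v : H, E (u + v) + E (u - v) = 2 * E u + 2 * E v

/-- `E` is closed: an `E`-Cauchy sequence of the domain that converges in `H` has its limit in the
domain and converges to it with respect to `E`. -/
def IsClosedForm {H : Type*} [NormedAddCommGroup H] (E : H → ℝ≥0∞) : Prop :=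
  ∀ (u : ℕ → H) (w : H), (∀ n, u n ∈ formDomain E) → Tendsto u atTop (𝓝 w) →
    Tendsto (fun p : ℕ × ℕ => E (u p.1 - u p.2)) atTop (𝓝 0) →
    w ∈ formDomain E ∧ Tendsto (fun n => E (u n - w)) atTop (𝓝 0)

/-- `E` is a Dirichlet form on `L²(μ)`: a densely defined closed quadratic form on which the unit
contraction `u ↦ min (max u 0) 1` operates. -/
def IsDirichletForm {α : Type*} [MeasurableSpace α] {μ : Measure α} (E : Lp ℝ 2 μ → ℝ≥0∞) :
    Prop :=
  IsQuadraticForm E ∧ Dense (formDomain E) ∧ IsClosedForm E ∧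
  ∀ u v : Lp ℝ 2 μ, (∀ᵐ x ∂μ, v x = min (max (u x) 0) 1) → E v ≤ E u

/-- `E` is the Mosco limit, as `l ↓ 0`, of the family of forms `q l`, `l > 0`. -/
def IsMoscoLimit {H : Type*} [NormedAddCommGroup H] [InnerProductSpace ℝ H]
    (q : ℝ → H → ℝ≥0∞) (E : H → ℝ≥0∞) : Prop :=
  ∀ l : ℕ → ℝ, Tendsto l atTop (𝓝[>] 0) →
    (∀ (u : ℕ → H) (w : H),
      (∀ v : H, Tendsto (fun n => inner ℝ (u n) v) atTop (𝓝 (inner ℝ w v))) →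
      E w ≤ liminf (fun n => q (l n) (u n)) atTop) ∧
    ∀ w : H, ∃ u : ℕ → H, Tendsto u atTop (𝓝 w) ∧
      limsup (fun n => q (l n) (u n)) atTop ≤ E w

/-- The operator `L` associated with the form `E` (Kato's representation theorem), as a relation:
`u ∈ D(L)` and `L u = g` iff `u ∈ D(E)` and `E(u, v) = ⟨g, v⟩` for all `v ∈ D(E)`. -/
def IsFormOperator {H : Type*} [NormedAddCommGroup H] [InnerProductSpace ℝ H]
    (E : H → ℝ≥0∞) (u g : H) : Prop :=
  u ∈ formDomain E ∧ ∀ v ∈ formDomain E, polarForm E u v = inner ℝ g v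

/-- `T = (e^{-tL})_{t ≥ 0}`, where `L` is the operator associated with `E`: the strongly continuous
contraction semigroup whose infinitesimal generator is `-L`. Only `T t` with `t ≥ 0` matters. -/
def IsFormSemigroup {H : Type*} [NormedAddCommGroup H] [InnerProductSpace ℝ H]
    (E : H → ℝ≥0∞) (T : ℝ → H →L[ℝ] H) : Prop :=
  T 0 = ContinuousLinearMap.id ℝ H ∧
  (∀ s t : ℝ, 0 ≤ s → 0 ≤ t → T (s + t) = (T s).comp (T t)) ∧
  (∀ f : H, ContinuousOn (fun t => T t f) (Ici 0)) ∧
  (∀ t : ℝ, 0 ≤ t → ‖T t‖ ≤ 1) ∧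
  ∀ u g : H, IsFormOperator E u g ↔
    Tendsto (fun t : ℝ => t⁻¹ • (u - T t u)) (𝓝[>] 0) (𝓝 g)

/-- Transience of the semigroup: for every `f ≥ 0` in `L¹(μ) ∩ L²(μ)` the potential
`G f = sup_M ∫_0^M T_s f ds` is finite almost everywhere. -/
def IsTransientSemigroup {α : Type*} [MeasurableSpace α] {μ : Measure α}
    (T : ℝ → Lp ℝ 2 μ →L[ℝ] Lp ℝ 2 μ) : Prop :=
  ∀ f : Lp ℝ 2 μ, (∀ᵐ x ∂μ, 0 ≤ f x) → Integrable f μ →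
    ∃ h : α → ℝ, ∀ M : ℝ, 0 ≤ M → ∀ᵐ x ∂μ, (∫ s in (0 : ℝ)..M, T s f) x ≤ h x

/-- Transience of the form: there is a bounded integrable reference function `g > 0` with
`∫ |u| g dμ ≤ E[u]^{1/2}` for all `u` in the domain. -/
def IsTransientForm {α : Type*} [MeasurableSpace α] {μ : Measure α} (E : Lp ℝ 2 μ → ℝ≥0∞) :
    Prop :=
  ∃ g : α → ℝ, Measurable g ∧ (∃ C : ℝ, ∀ x, |g x| ≤ C) ∧ Integrable g μ ∧ (∀ᵐ x ∂μ, 0 < g x) ∧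
    ∀ u ∈ formDomain E, (∫⁻ x, ENNReal.ofReal (|u x| * g x) ∂μ) ≤ E u ^ (1 / 2 : ℝ)

/-- A set `A` is invariant: `T_t (1_A f) = 1_A T_t f` for all `t > 0` and `f ∈ L²(μ)`. -/
def IsInvariantSet {α : Type*} [MeasurableSpace α] {μ : Measure α}
    (T : ℝ → Lp ℝ 2 μ →L[ℝ] Lp ℝ 2 μ) (A : Set α) : Prop :=
  MeasurableSet A ∧ ∀ t : ℝ, 0 < t → ∀ f g : Lp ℝ 2 μ,
    g =ᵐ[μ] A.indicator f → T t g =ᵐ[μ] A.indicator (T t f)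

/-- Irreducibility: every invariant set is null or has null complement. -/
def IsIrreducibleSemigroup {α : Type*} [MeasurableSpace α] {μ : Measure α}
    (T : ℝ → Lp ℝ 2 μ →L[ℝ] Lp ℝ 2 μ) : Prop :=
  ∀ A : Set α, IsInvariantSet T A → μ A = 0 ∨ μ Aᶜ = 0

/-- Conservativeness: `T_t 1 = 1` for some (equivalently, every) `t > 0`. Here `μ` is finite, so
that `1 ∈ L^∞(μ) ⊆ L²(μ)` and the `L^∞`-semigroup is the restriction of `T`. -/
def IsConservativeSemigroup {α : Type*} [MeasurableSpace α] {μ : Measure α} [IsFiniteMeasure μ]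
    (T : ℝ → Lp ℝ 2 μ →L[ℝ] Lp ℝ 2 μ) : Prop :=
  ∃ t : ℝ, 0 < t ∧ T t (Lp.const 2 μ 1) = Lp.const 2 μ 1

/-! ### The Dirichlet form of the three-dimensional Bessel process and its traces -/

/-- The domain of the Bessel form on `I = (0, ∞)`, `dm = 2 x² dx`: the (locally) absolutely
continuous `u : I → ℝ` with `∫ u'² x² dx < ∞` and `u ∈ L²(I, m)`. A function on `I` is represented
by its extension by zero to `ℝ`. -/
def besselDomain : Set (ℝ → ℝ) :=
  {u | (∀ x ≤ 0, u x = 0) ∧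
    (∀ a b : ℝ, 0 < a → a ≤ b → AbsolutelyContinuousOnInterval u a b) ∧
    IntegrableOn (fun x => deriv u x ^ 2 * x ^ 2) (Ioi 0) ∧
    IntegrableOn (fun x => u x ^ 2 * (2 * x ^ 2)) (Ioi 0)}

/-- `E_l(u, v) = ∫_0^∞ u' v' x² dx + l ∫_0^∞ u v dm`, with `dm = 2 x² dx`. -/
def besselForm (l : ℝ) (u v : ℝ → ℝ) : ℝ :=
  (∫ x in Ioi (0 : ℝ), deriv u x * deriv v x * x ^ 2) +
    l * ∫ x in Ioi (0 : ℝ), u x * v x * (2 * x ^ 2)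

/-- The graph of the restriction operator `J`: `u` lies in the Bessel domain and in `L²(μ)`, and
`f` is its class in `L²(μ)`. -/
def IsRestriction (μ : Measure ℝ) (u : ℝ → ℝ) (f : Lp ℝ 2 μ) : Prop :=
  u ∈ besselDomain ∧ u =ᵐ[μ] f

/-- The kernel of `J`. -/
def restrictionKernel (μ : Measure ℝ) : Set (ℝ → ℝ) := {u | IsRestriction μ u 0}

/-- The `E_l`-orthogonal complement of `ker J` in the Bessel domain. -/
def restrictionKernelPerp (μ : Measure ℝ) (l : ℝ) : Set (ℝ → ℝ) :=
  {w | w ∈ besselDomain ∧ ∀ v ∈ restrictionKernel μ, besselForm l w v = 0}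

/-- `w = P_l u`: `w` is the `E_l`-orthogonal projection of `u` onto the `E_l`-orthogonal complement
of `ker J`. -/
def IsProjection (μ : Measure ℝ) (l : ℝ) (u w : ℝ → ℝ) : Prop :=
  w ∈ restrictionKernelPerp μ l ∧ ∀ z ∈ restrictionKernelPerp μ l, besselForm l (u - w) z = 0

/-- The approximating form on `L²(μ)`, with domain `ran J` and `J u ↦ E_l[P_l u]`. The infimum is
over the values `E_l[P_l u]` with `J u = f`; they all agree, and there are none (so that the value
is `∞`) exactly when `f ∉ ran J`. -/
def approxTrace (μ : Measure ℝ) (l : ℝ) (f : Lp ℝ 2 μ) : ℝ≥0∞ :=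
  ⨅ (u : ℝ → ℝ) (w : ℝ → ℝ) (_ : IsRestriction μ u f ∧ IsProjection μ l u w),
    ENNReal.ofReal (besselForm l w w)

/-- `E` is the trace of the Bessel form with respect to `μ`, a measure carried by `(0, ∞)`: the
Mosco limit of the approximating forms as `l ↓ 0`. -/
def IsBesselTrace (μ : Measure ℝ) (E : Lp ℝ 2 μ → ℝ≥0∞) : Prop :=
  IsMoscoLimit (approxTrace μ) E

/-! ### Finitely supported measures -/

/-- `μ = ∑_{k=1}^N a_k δ_k`. -/
def atomicMeasure (N : ℕ) (a : ℕ → ℝ) : Measure ℝ :=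
  ∑ k ∈ Finset.Icc 1 N, ENNReal.ofReal (a k) • Measure.dirac (k : ℝ)

instance instIsFiniteMeasureAtomicMeasure (N : ℕ) (a : ℕ → ℝ) :
    IsFiniteMeasure (atomicMeasure N a) := by
  constructor
  simp [atomicMeasure]

/-- `u ↦ (u(1), …, u(N))`, from `L²(μ)` to `ℝ^N`. -/
def evalVector {N : ℕ} {a : ℕ → ℝ} (u : Lp ℝ 2 (atomicMeasure N a)) : Fin N → ℝ :=
  fun k => u (((k : ℕ) : ℝ) + 1)

/-- The jump form `∑_{k,j=1}^N b(k, j) (u_k - u_j)²`. -/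
def atomicJumpForm {N : ℕ} {a : ℕ → ℝ} (b : ℕ → ℕ → ℝ) (u : Lp ℝ 2 (atomicMeasure N a)) : ℝ≥0∞ :=
  ENNReal.ofReal (∑ k ∈ Finset.Icc 1 N, ∑ j ∈ Finset.Icc 1 N, b k j * (u (k : ℝ) - u (j : ℝ)) ^ 2)

/-- The killing form `∑_{k=1}^N κ(k) u_k²`. -/
def atomicKillingForm {N : ℕ} {a : ℕ → ℝ} (κ : ℕ → ℝ) (u : Lp ℝ 2 (atomicMeasure N a)) : ℝ≥0∞ :=
  ENNReal.ofReal (∑ k ∈ Finset.Icc 1 N, κ k * u (k : ℝ) ^ 2)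

/-- Jump rates: `b(k, j) = k j / 2` if `|k - j| = 1`, and `0` otherwise. -/
def besselJumpRate (k j : ℕ) : ℝ :=
  if k = j + 1 ∨ j = k + 1 then (k : ℝ) * (j : ℝ) / 2 else 0

/-- Killing only happens at `N`, with rate `N`. -/
def besselKillingRate (N k : ℕ) : ℝ := if k = N then (N : ℝ) else 0

end

/-! Points have positive capacity for this form. With `l = s² / 2`, the form `E_l` on the Bessel
domain has a reproducing kernel at every `y > 0`: the function `G_y` glued from the solutions of
`(x² p')' = s² x² p` that are regular at `0` and decaying at `∞`, normalized so that `x² G_y'` drops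
by one across `y`. This is `besselForm_resolventKernel`.

Hence `ker J` is the set of functions orthogonal to `G_1, …, G_N`. A function with values `f` on the
atoms projects to the combination of the `G_i` that interpolates `f`, and its energy is `f M_s⁻¹ f`,
where `M_s` is the matrix of values of the kernels (`approxTrace_atomicMeasure`).

As `s ↓ 0`, `M_s` tends to the matrix with entries `1 / max i j`. After the substitution `h_k = k
g_k` (the h-transform from the Bessel process to Brownian motion) it becomes the matrix `min i j`,
whose inverse has the quadratic form `∑ (h_{k+1} - h_k)²`, `0 ≤ k < N`, `h_0 = 0`. Expanding these
squares gives the stated energy (`traceEnergy_eq_sum_sq`, `exists_vecMul_greenMatrix`). Since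
`L²(μ)` has finite dimension, weak convergence is convergence of the coordinates, and continuity of
matrix inversion yields both Mosco conditions.

The rest is read off from the explicit form. Telescoping `h` gives `|g_k| ≤ E[g]^{1/2}`, which
yields transience and the invertibility of `L`. The entries of `L` between neighbouring atoms do not
vanish, hence irreducibility. Finally `E[1] = N ≠ 0` excludes conservativeness. The semigroup
statements use only the semigroup law, contractivity, strong continuity and the generator, so they
hold for every `T` with `IsFormSemigroup`. -/

noncomputable section

/-! ### The Bessel domain and the resolvent kernel -/

/-- The solution `e^{-s y} sinh (s x) / (s y x)` of `(x² p')' = s² x² p` that is regular at `0`. -/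
def innerSolution (s y x : ℝ) : ℝ := Real.exp (-s * y) * Real.sinh (s * x) / (s * y * x)

/-- The solution `sinh (s y) e^{-s x} / (s y x)` of `(x² p')' = s² x² p` that decays at `∞`. -/
def outerSolution (s y x : ℝ) : ℝ := Real.sinh (s * y) * Real.exp (-s * x) / (s * y * x)

/-- `x² p'(x)` for the inner solution `p`. -/
def innerFlux (s y x : ℝ) : ℝ :=
  Real.exp (-s * y) * (s * x * Real.cosh (s * x) - Real.sinh (s * x)) / (s * y)

/-- `x² p'(x)` for the outer solution `p`. -/
def outerFlux (s y x : ℝ) : ℝ := -(Real.sinh (s * y) * (Real.exp (-s * x) * (s * x + 1))) / (s * y)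

/-- The reproducing kernel at `y` of the Bessel form `E_l`, where `l = s² / 2`. -/
def resolventKernel (s y x : ℝ) : ℝ :=
  if x ≤ 0 then 0 else if x ≤ y then innerSolution s y x else outerSolution s y x

/-- `x² G'(x)` for the resolvent kernel `G`, away from the pole. -/
def resolventFlux (s y x : ℝ) : ℝ := if x ≤ y then innerFlux s y x else outerFlux s y x

lemma hasDerivAt_innerSolution {s y x : ℝ} (hs : 0 < s) (hy : 0 < y) (hx : 0 < x) :
    HasDerivAt (innerSolution s y) (innerFlux s y x / x ^ 2) x := by
  have h1 : HasDerivAt (fun x : ℝ => s * x) s x := by simpa using (hasDerivAt_id x).const_mul s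
  have h2 : HasDerivAt (fun x : ℝ => s * y * x) (s * y) x := by
    simpa using (hasDerivAt_id x).const_mul (s * y)
  refine ((h1.sinh.const_mul (Real.exp (-s * y))).fun_div h2 (by positivity)).congr_deriv ?_
  simp only [innerFlux]
  field_simp

lemma hasDerivAt_outerSolution {s y x : ℝ} (hs : 0 < s) (hy : 0 < y) (hx : 0 < x) :
    HasDerivAt (outerSolution s y) (outerFlux s y x / x ^ 2) x := by
  have h1 : HasDerivAt (fun x : ℝ => -s * x) (-s) x := by simpa using (hasDerivAt_id x).const_mul (-s)
  have h2 : HasDerivAt (fun x : ℝ => s * y * x) (s * y) x := by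
    simpa using (hasDerivAt_id x).const_mul (s * y)
  refine ((h1.exp.const_mul (Real.sinh (s * y))).fun_div h2 (by positivity)).congr_deriv ?_
  simp only [outerFlux]
  field_simp
  ring

lemma hasDerivAt_innerFlux {s y x : ℝ} (hs : 0 < s) (hy : 0 < y) :
    HasDerivAt (innerFlux s y) (s ^ 2 * x ^ 2 * innerSolution s y x) x := by
  have h1 : HasDerivAt (fun x : ℝ => s * x) s x := by simpa using (hasDerivAt_id x).const_mul s
  refine ((((h1.fun_mul h1.cosh).fun_sub h1.sinh).const_mul (Real.exp (-s * y))).div_const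
    (s * y)).congr_deriv ?_
  simp only [innerSolution]
  -- At `0` the inner solution is `0` by division by zero, and the factor `x²` makes this harmless.
  -- The point is needed because `exists_abs_innerFlux_le` starts from `0`.
  rcases eq_or_ne x 0 with rfl | hx
  · simp
  · field_simp
    ring

lemma hasDerivAt_outerFlux {s y x : ℝ} (hs : 0 < s) (hy : 0 < y) :
    HasDerivAt (outerFlux s y) (s ^ 2 * x ^ 2 * outerSolution s y x) x := by
  have h1 : HasDerivAt (fun x : ℝ => -s * x) (-s) x := by simpa using (hasDerivAt_id x).const_mul (-s)
  have h2 : HasDerivAt (fun x : ℝ => s * x + 1) s x := by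
    simpa using ((hasDerivAt_id x).const_mul s).add_const 1
  refine ((((h1.exp.fun_mul h2).const_mul (Real.sinh (s * y))).fun_neg).div_const
    (s * y)).congr_deriv ?_
  simp only [outerSolution]
  field_simp
  ring

/-- The Wronskian normalization: this unit jump is what makes the kernel reproduce `v y` with
constant one. -/
lemma innerFlux_sub_outerFlux {s y : ℝ} (hs : 0 < s) (hy : 0 < y) :
    innerFlux s y y - outerFlux s y y = 1 := by
  have h : Real.exp (-s * y) * (Real.cosh (s * y) + Real.sinh (s * y)) = 1 := by
    rw [Real.cosh_add_sinh, ← Real.exp_add]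
    simp
  simp only [innerFlux, outerFlux]
  have hs' : s * y ≠ 0 := by positivity
  rw [← sub_div, div_eq_iff hs']
  linear_combination (s * y) * h

lemma innerSolution_self (s y : ℝ) : innerSolution s y y = outerSolution s y y := by
  simp only [innerSolution, outerSolution]
  ring

lemma measurable_resolventKernel (s y : ℝ) : Measurable (resolventKernel s y) := by
  unfold resolventKernel innerSolution outerSolution
  refine Measurable.ite measurableSet_Iic measurable_const (Measurable.ite measurableSet_Iic ?_ ?_)
  · exact ((Real.measurable_sinh.comp (measurable_id.const_mul s)).const_mul _).div
      (measurable_id.const_mul _)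
  · exact ((Real.measurable_exp.comp (measurable_id.const_mul (-s))).const_mul _).div
      (measurable_id.const_mul _)

lemma measurable_resolventFlux (s y : ℝ) : Measurable (resolventFlux s y) := by
  unfold resolventFlux innerFlux outerFlux
  refine Measurable.ite measurableSet_Iic (Continuous.measurable ?_) (Continuous.measurable ?_)
  · fun_prop
  · fun_prop

lemma hasDerivAt_resolventKernel {s y x : ℝ} (hs : 0 < s) (hy : 0 < y) (hx : 0 < x) (hxy : x ≠ y) :
    HasDerivAt (resolventKernel s y) (resolventFlux s y x / x ^ 2) x := by
  rcases lt_or_gt_of_ne hxy with h | h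
  · rw [resolventFlux, if_pos h.le]
    refine (hasDerivAt_innerSolution hs hy hx).congr_of_eventuallyEq ?_
    filter_upwards [Ioo_mem_nhds hx h] with z hz
    rw [resolventKernel, if_neg (not_le.2 hz.1), if_pos hz.2.le]
  · rw [resolventFlux, if_neg (not_le.2 h)]
    refine (hasDerivAt_outerSolution hs hy hx).congr_of_eventuallyEq ?_
    filter_upwards [Ioi_mem_nhds hx, Ioi_mem_nhds h] with z hz hz'
    rw [resolventKernel, if_neg (not_le.2 hz), if_neg (not_le.2 hz')]

/-- The kernel has a kink at `y`. Stopping the two smooth branches at `y` by `min` and `max` writes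
it as a sum of Lipschitz functions, with no case distinction on the position of `y`. -/
lemma absolutelyContinuousOnInterval_resolventKernel {s y a b : ℝ} (hs : 0 < s) (hy : 0 < y)
    (ha : 0 < a) (hab : a ≤ b) : AbsolutelyContinuousOnInterval (resolventKernel s y) a b := by
  -- The interval is enlarged so as to contain `min x y` and `max x y` for all `x ∈ [a, b]`.
  have h1 : ∃ K, LipschitzOnWith K (innerSolution s y) (Icc (min a y) (max b y)) := by
    refine ContDiffOn.exists_lipschitzOnWith (n := 1) ?_ (by decide) (convex_Icc _ _) isCompact_Icc
    unfold innerSolution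
    refine ContDiffOn.div (by fun_prop) (by fun_prop) fun x hx => ?_
    have : 0 < x := (lt_min ha hy).trans_le hx.1
    positivity
  have h2 : ∃ K, LipschitzOnWith K (outerSolution s y) (Icc (min a y) (max b y)) := by
    refine ContDiffOn.exists_lipschitzOnWith (n := 1) ?_ (by decide) (convex_Icc _ _) isCompact_Icc
    unfold outerSolution
    refine ContDiffOn.div (by fun_prop) (by fun_prop) fun x hx => ?_
    have : 0 < x := (lt_min ha hy).trans_le hx.1
    positivity
  obtain ⟨K₁, h1⟩ := h1
  obtain ⟨K₂, h2⟩ := h2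
  have h3 : LipschitzOnWith K₁ (fun x => innerSolution s y (min x y)) (uIcc a b) := by
    have := h1.comp (f := fun x => min x y) (s := uIcc a b)
      ((LipschitzWith.id.min_const y).lipschitzOnWith) (fun x hx => by
        rw [uIcc_of_le hab] at hx
        exact ⟨min_le_min_right y hx.1, (min_le_right x y).trans (le_max_right b y)⟩)
    rwa [mul_one] at this
  have h4 : LipschitzOnWith K₂ (fun x => outerSolution s y (max x y)) (uIcc a b) := by
    have := h2.comp (f := fun x => max x y) (s := uIcc a b)
      ((LipschitzWith.id.max_const y).lipschitzOnWith) (fun x hx => by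
        rw [uIcc_of_le hab] at hx
        exact ⟨(min_le_right a y).trans (le_max_right x y), max_le_max_right y hx.2⟩)
    rwa [mul_one] at this
  have h5 : LipschitzOnWith (K₁ + K₂ + 0) (resolventKernel s y) (uIcc a b) := by
    have h6 := (h3.add h4).sub (LipschitzWith.const (innerSolution s y y)).lipschitzOnWith
    have h7 : EqOn (resolventKernel s y) (fun x => innerSolution s y (min x y) +
        outerSolution s y (max x y) - innerSolution s y y) (uIcc a b) := by
      intro x hx
      rw [uIcc_of_le hab] at hx
      simp only
      rw [resolventKernel, if_neg (not_le.2 (ha.trans_le hx.1))]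
      rcases le_or_gt x y with h | h
      · simp [h, innerSolution_self]
      · simp [h.le, not_le.2 h]
    intro x hx z hz
    rw [h7 hx, h7 hz]
    exact h6 hx hz
  exact h5.absolutelyContinuousOnInterval

/-- The inner flux vanishes at `0`, and its derivative is a constant times `x sinh (s x)`, so it is
at most `c x` on `[0, y]`. The quadratic bound removes the boundary term at `0` in the reproducing
property. -/
lemma exists_abs_innerFlux_le {s y : ℝ} (hs : 0 < s) (hy : 0 < y) :
    ∃ K, 0 ≤ K ∧ ∀ x, 0 ≤ x → x ≤ y → |innerFlux s y x| ≤ K * x ^ 2 := by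
  set c := Real.exp (-s * y) / (s * y) * s ^ 2 * Real.sinh (s * y) with hc
  have hc0 : 0 ≤ c := by
    have : 0 ≤ Real.sinh (s * y) := Real.sinh_nonneg_iff.2 (by positivity)
    positivity
  refine ⟨c, hc0, fun x hx hxy => ?_⟩
  have := (convex_Icc 0 x).norm_image_sub_le_of_norm_hasDerivWithin_le (f := innerFlux s y)
    (C := c * x) (fun z _ => (hasDerivAt_innerFlux hs hy).hasDerivWithinAt) (fun z hz => ?_)
    (left_mem_Icc.2 hx) (right_mem_Icc.2 hx)
  · rwa [Real.norm_eq_abs, Real.norm_eq_abs, sub_zero, abs_of_nonneg hx,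
      show innerFlux s y 0 = 0 by simp [innerFlux], sub_zero, mul_assoc, ← pow_two] at this
  · have hz0 : 0 ≤ z := hz.1
    have h1 : 0 ≤ Real.sinh (s * z) := Real.sinh_nonneg_iff.2 (by positivity)
    have h2 : Real.sinh (s * z) ≤ Real.sinh (s * y) :=
      Real.sinh_le_sinh.2 (mul_le_mul_of_nonneg_left (hz.2.trans hxy) hs.le)
    have h3 : s ^ 2 * z ^ 2 * innerSolution s y z
        = Real.exp (-s * y) / (s * y) * s ^ 2 * Real.sinh (s * z) * z := by
      rw [innerSolution]
      rcases eq_or_ne z 0 with rfl | hz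
      · simp
      · field_simp
    rw [h3, Real.norm_of_nonneg (by positivity), hc]
    gcongr
    exact hz.2

lemma exists_abs_mul_resolventKernel_le {s y : ℝ} (hs : 0 < s) (hy : 0 < y) :
    ∃ C, 0 ≤ C ∧ ∀ x, 0 < x → |resolventKernel s y x * x| ≤ C * Real.exp (-s * x) := by
  have hsh : 0 ≤ Real.sinh (s * y) := Real.sinh_nonneg_iff.2 (by positivity)
  refine ⟨Real.sinh (s * y) / (s * y), by positivity, fun x hx => ?_⟩
  rw [resolventKernel, if_neg (not_le.2 hx)]
  split_ifs with h
  · have h1 : 0 ≤ Real.sinh (s * x) := Real.sinh_nonneg_iff.2 (by positivity)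
    have h2 : Real.sinh (s * x) ≤ Real.sinh (s * y) :=
      Real.sinh_le_sinh.2 (mul_le_mul_of_nonneg_left h hs.le)
    have h3 : Real.exp (-s * y) ≤ Real.exp (-s * x) := Real.exp_le_exp.2 (by nlinarith)
    have h4 : innerSolution s y x * x = Real.sinh (s * x) / (s * y) * Real.exp (-s * y) := by
      rw [innerSolution]; field_simp
    rw [h4, abs_of_nonneg (by positivity)]
    gcongr
  · have h4 : outerSolution s y x * x = Real.sinh (s * y) / (s * y) * Real.exp (-s * x) := by
      rw [outerSolution]; field_simp
    rw [h4, abs_of_nonneg (by positivity)]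

/-- Away from the pole the quotient is `x G'(x)`, so this bound yields finite energy. Below `y` any
bounded function is dominated by a multiple of the exponential, whence the factor `exp (s y)`. -/
lemma exists_abs_resolventFlux_div_le {s y : ℝ} (hs : 0 < s) (hy : 0 < y) :
    ∃ C, 0 ≤ C ∧ ∀ x, 0 < x → |resolventFlux s y x / x| ≤ C * Real.exp (-s * x) := by
  have hsh : 0 ≤ Real.sinh (s * y) := Real.sinh_nonneg_iff.2 (by positivity)
  obtain ⟨K, hK, hF⟩ := exists_abs_innerFlux_le hs hy
  refine ⟨max (K * y * Real.exp (s * y)) (Real.sinh (s * y) / (s * y) * (s + 1 / y)),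
    by positivity, fun x hx => ?_⟩
  rw [resolventFlux]
  split_ifs with h
  · have h1 : |innerFlux s y x / x| ≤ K * x := by
      rw [abs_div, abs_of_pos hx, div_le_iff₀ hx]
      calc _ ≤ K * x ^ 2 := hF x hx.le h
        _ = _ := by ring
    calc _ ≤ K * x := h1
      _ ≤ K * y * 1 := by rw [mul_one]; gcongr
      _ ≤ K * y * (Real.exp (s * y) * Real.exp (-s * x)) := by
        gcongr
        rw [← Real.exp_add]
        exact Real.one_le_exp (by nlinarith)
      _ = K * y * Real.exp (s * y) * Real.exp (-s * x) := by ring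
      _ ≤ _ := by gcongr; exact le_max_left _ _
  · have h4 : outerFlux s y x / x
        = -(Real.sinh (s * y) / (s * y) * (s + 1 / x) * Real.exp (-s * x)) := by
      rw [outerFlux]; field_simp
    rw [h4, abs_neg, abs_of_nonneg (by positivity)]
    gcongr
    refine le_trans ?_ (le_max_right _ _)
    push Not at h
    gcongr

lemma integrableOn_sq_of_abs_le_exp {f : ℝ → ℝ} {s C : ℝ} (hs : 0 < s) (hf : Measurable f)
    (h : ∀ x, 0 < x → |f x| ≤ C * Real.exp (-s * x)) :
    IntegrableOn (fun x => f x ^ 2) (Ioi 0) := by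
  refine Integrable.mono' ((exp_neg_integrableOn_Ioi 0 hs).const_mul (C ^ 2))
    (hf.pow_const 2).aestronglyMeasurable ?_
  filter_upwards [ae_restrict_mem measurableSet_Ioi] with x hx
  have hx : 0 < x := hx
  have h1 : Real.exp (-s * x) ≤ 1 := Real.exp_le_one_iff.2 (by nlinarith)
  rw [Real.norm_of_nonneg (by positivity), ← sq_abs]
  calc |f x| ^ 2 ≤ (C * Real.exp (-s * x)) ^ 2 := by gcongr; exact h x hx
    _ = C ^ 2 * (Real.exp (-s * x) * Real.exp (-s * x)) := by ring
    _ ≤ C ^ 2 * (Real.exp (-s * x) * 1) := by gcongr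
    _ = _ := by ring

lemma ae_deriv_resolventKernel {s y : ℝ} (hs : 0 < s) (hy : 0 < y) :
    ∀ᵐ x ∂volume.restrict (Ioi 0),
      deriv (resolventKernel s y) x = resolventFlux s y x / x ^ 2 := by
  have h : ∀ᵐ x ∂(volume : Measure ℝ), x ≠ y := by simp [ae_iff]
  filter_upwards [ae_restrict_mem measurableSet_Ioi, ae_restrict_of_ae h] with x hx hxy
  exact (hasDerivAt_resolventKernel hs hy hx hxy).deriv

lemma resolventKernel_mem_besselDomain {s y : ℝ} (hs : 0 < s) (hy : 0 < y) :
    resolventKernel s y ∈ besselDomain := by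
  refine ⟨fun x hx => if_pos hx, fun a b ha hab =>
    absolutelyContinuousOnInterval_resolventKernel hs hy ha hab, ?_, ?_⟩
  · obtain ⟨C, -, hC⟩ := exists_abs_resolventFlux_div_le hs hy
    refine (integrableOn_sq_of_abs_le_exp hs ((measurable_resolventFlux s y).div measurable_id)
      hC).congr ?_
    filter_upwards [ae_restrict_mem measurableSet_Ioi, ae_deriv_resolventKernel hs hy] with x hx h
    have hx : 0 < x := hx
    rw [h]
    simp only [Pi.div_apply, id]
    field_simp
  · obtain ⟨C, -, hC⟩ := exists_abs_mul_resolventKernel_le hs hy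
    have h := integrableOn_sq_of_abs_le_exp hs ((measurable_resolventKernel s y).mul measurable_id)
      hC
    refine (h.const_mul 2).congr (Eventually.of_forall fun x => ?_)
    simp only [Pi.mul_apply, id]
    ring

/-! ### Linear structure of the Bessel domain -/

/-- Exhaust `(0, ∞)` by the intervals `[1/(n+1), n+1]`, on which absolute continuity gives
differentiability a.e. This makes `deriv` additive a.e. on the domain. -/
lemma differentiableAt_ae_of_mem_besselDomain {u : ℝ → ℝ} (hu : u ∈ besselDomain) :
    ∀ᵐ x ∂volume.restrict (Ioi 0), DifferentiableAt ℝ u x := by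
  rw [ae_restrict_iff' measurableSet_Ioi]
  have h : ∀ n : ℕ, ∀ᵐ x : ℝ, x ∈ uIcc (1 / ((n : ℝ) + 1)) ((n : ℝ) + 1) →
      DifferentiableAt ℝ u x := fun n =>
    (hu.2.1 _ _ (by positivity) (by
      rw [div_le_iff₀ (by positivity)]
      nlinarith [(Nat.cast_nonneg n : (0 : ℝ) ≤ n)])).ae_differentiableAt
  filter_upwards [ae_all_iff.2 h] with x hx hx0
  obtain ⟨n, hn⟩ := exists_nat_one_div_lt (show (0 : ℝ) < x from hx0)
  obtain ⟨m, hm⟩ := exists_nat_gt x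
  have h1 : (n : ℝ) ≤ (max n m : ℕ) := by exact_mod_cast le_max_left n m
  have h2 : (m : ℝ) ≤ (max n m : ℕ) := by exact_mod_cast le_max_right n m
  refine hx (max n m) (mem_uIcc_of_le ?_ (by linarith))
  refine le_trans ?_ hn.le
  gcongr

lemma continuousOn_of_mem_besselDomain {u : ℝ → ℝ} (hu : u ∈ besselDomain) :
    ContinuousOn u (Ioi 0) := by
  intro x hx
  have hx : 0 < x := hx
  have h := (hu.2.1 (x / 2) (x + 1) (by positivity) (by linarith)).continuousOn
  rw [uIcc_of_le (by linarith)] at h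
  exact (h.continuousAt (Icc_mem_nhds (by linarith) (by linarith))).continuousWithinAt

/-- With the weight `x²` split evenly between two factors, mixed terms are products of two `L²`
functions for Lebesgue measure. -/
lemma memLp_deriv_of_mem_besselDomain {u : ℝ → ℝ} (hu : u ∈ besselDomain) :
    MemLp (fun x => deriv u x * x) 2 (volume.restrict (Ioi 0)) := by
  refine (memLp_two_iff_integrable_sq
    ((measurable_deriv u).mul measurable_id).aestronglyMeasurable).2 (hu.2.2.1.congr ?_)
  exact Eventually.of_forall fun x => by simp only [Pi.mul_apply, id]; ring

lemma memLp_mul_of_mem_besselDomain {u : ℝ → ℝ} (hu : u ∈ besselDomain) :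
    MemLp (fun x => u x * x) 2 (volume.restrict (Ioi 0)) := by
  refine (memLp_two_iff_integrable_sq (((continuousOn_of_mem_besselDomain hu).mul
    continuousOn_id).aestronglyMeasurable measurableSet_Ioi)).2 ((hu.2.2.2.const_mul 2⁻¹).congr ?_)
  exact Eventually.of_forall fun x => by simp only [Pi.mul_apply, id]; ring

lemma integrableOn_deriv_mul_deriv {u v : ℝ → ℝ} (hu : u ∈ besselDomain) (hv : v ∈ besselDomain) :
    IntegrableOn (fun x => deriv u x * deriv v x * x ^ 2) (Ioi 0) := by
  refine ((memLp_deriv_of_mem_besselDomain hu).integrable_mul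
    (memLp_deriv_of_mem_besselDomain hv)).congr (Eventually.of_forall fun x => ?_)
  simp only [Pi.mul_apply]
  ring

lemma integrableOn_mul_mul {u v : ℝ → ℝ} (hu : u ∈ besselDomain) (hv : v ∈ besselDomain) :
    IntegrableOn (fun x => u x * v x * (2 * x ^ 2)) (Ioi 0) := by
  refine (((memLp_mul_of_mem_besselDomain hu).integrable_mul
    (memLp_mul_of_mem_besselDomain hv)).const_mul 2).congr (Eventually.of_forall fun x => ?_)
  simp only [Pi.mul_apply]
  ring

lemma add_mem_besselDomain {u v : ℝ → ℝ} (hu : u ∈ besselDomain) (hv : v ∈ besselDomain) :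
    u + v ∈ besselDomain := by
  refine ⟨fun x hx => by simp [hu.1 x hx, hv.1 x hx],
    fun a b ha hab => (hu.2.1 a b ha hab).add (hv.2.1 a b ha hab), ?_, ?_⟩
  · refine ((hu.2.2.1.add hv.2.2.1).add ((integrableOn_deriv_mul_deriv hu hv).const_mul 2)).congr ?_
    filter_upwards [differentiableAt_ae_of_mem_besselDomain hu,
      differentiableAt_ae_of_mem_besselDomain hv] with x h1 h2
    rw [deriv_add h1 h2]
    simp only [Pi.add_apply]
    ring
  · refine ((hu.2.2.2.add hv.2.2.2).add ((integrableOn_mul_mul hu hv).const_mul 2)).congr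
      (Eventually.of_forall fun x => ?_)
    simp only [Pi.add_apply]
    ring

lemma smul_mem_besselDomain (c : ℝ) {u : ℝ → ℝ} (hu : u ∈ besselDomain) :
    c • u ∈ besselDomain := by
  refine ⟨fun x hx => by simp [hu.1 x hx], fun a b ha hab => (hu.2.1 a b ha hab).const_smul c,
    ?_, ?_⟩
  · refine (hu.2.2.1.const_mul (c ^ 2)).congr (Eventually.of_forall fun x => ?_)
    simp only [deriv_const_smul_field, smul_eq_mul]
    ring
  · refine (hu.2.2.2.const_mul (c ^ 2)).congr (Eventually.of_forall fun x => ?_)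
    simp only [Pi.smul_apply, smul_eq_mul]
    ring

/-- The Bessel domain as a vector space. -/
def besselSubmodule : Submodule ℝ (ℝ → ℝ) where
  carrier := besselDomain
  add_mem' := add_mem_besselDomain
  zero_mem' := by
    refine ⟨fun _ _ => rfl, fun a b _ _ =>
      (LipschitzWith.const (0 : ℝ)).lipschitzOnWith.absolutelyContinuousOnInterval, ?_, ?_⟩ <;> simp
  smul_mem' c _ := smul_mem_besselDomain c

lemma besselForm_comm (l : ℝ) (u v : ℝ → ℝ) : besselForm l u v = besselForm l v u := by
  simp only [besselForm, mul_comm]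

lemma besselForm_add_right (l : ℝ) {u v w : ℝ → ℝ} (hu : u ∈ besselDomain) (hv : v ∈ besselDomain)
    (hw : w ∈ besselDomain) : besselForm l u (v + w) = besselForm l u v + besselForm l u w := by
  have h1 : ∫ x in Ioi (0 : ℝ), deriv u x * deriv (v + w) x * x ^ 2
      = (∫ x in Ioi (0 : ℝ), deriv u x * deriv v x * x ^ 2)
        + ∫ x in Ioi (0 : ℝ), deriv u x * deriv w x * x ^ 2 := by
    rw [← integral_add (integrableOn_deriv_mul_deriv hu hv) (integrableOn_deriv_mul_deriv hu hw)]
    refine integral_congr_ae ?_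
    filter_upwards [differentiableAt_ae_of_mem_besselDomain hv,
      differentiableAt_ae_of_mem_besselDomain hw] with x h1 h2
    rw [deriv_add h1 h2]
    ring
  have h2 : ∫ x in Ioi (0 : ℝ), u x * (v + w) x * (2 * x ^ 2)
      = (∫ x in Ioi (0 : ℝ), u x * v x * (2 * x ^ 2))
        + ∫ x in Ioi (0 : ℝ), u x * w x * (2 * x ^ 2) := by
    rw [← integral_add (integrableOn_mul_mul hu hv) (integrableOn_mul_mul hu hw)]
    refine integral_congr_ae (Eventually.of_forall fun x => ?_)
    simp only [Pi.add_apply]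
    ring
  rw [besselForm, h1, h2]
  simp only [besselForm]
  ring

lemma besselForm_smul_right (l c : ℝ) (u v : ℝ → ℝ) :
    besselForm l u (c • v) = c * besselForm l u v := by
  simp only [besselForm, deriv_const_smul_field, Pi.smul_apply, smul_eq_mul, mul_add]
  rw [mul_left_comm c l, ← integral_const_mul c, ← integral_const_mul c]
  congr 1
  · exact integral_congr_ae (Eventually.of_forall fun x => by ring)
  · congr 1
    exact integral_congr_ae (Eventually.of_forall fun x => by ring)

/-- The form `E_l` as a bilinear form on the Bessel domain. -/
def besselBilin (l : ℝ) : LinearMap.BilinForm ℝ besselSubmodule :=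
  LinearMap.mk₂ ℝ (fun u v => besselForm l u v)
    (fun u v w => by
      rw [besselForm_comm, Submodule.coe_add, besselForm_add_right l w.2 u.2 v.2,
        besselForm_comm l w, besselForm_comm l w])
    (fun c u v => by
      rw [besselForm_comm, Submodule.coe_smul, besselForm_smul_right, besselForm_comm l v]; rfl)
    (fun u v w => by rw [Submodule.coe_add, besselForm_add_right l u.2 v.2 w.2])
    (fun c u v => by rw [Submodule.coe_smul, besselForm_smul_right]; rfl)

/-! ### The reproducing property -/

/-- The integrand is `(v F)'`, so this is integration by parts for absolutely continuous functions;
`F` is Lipschitz because its derivative is bounded on `[a, b]`. -/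
lemma integral_deriv_mul_add_of_solution {v p F : ℝ → ℝ} {s a b : ℝ} (hv : v ∈ besselDomain)
    (ha : 0 < a) (hab : a ≤ b) (hp : ContinuousOn p (Icc a b))
    (hF : ∀ x ∈ Icc a b, HasDerivAt F (s ^ 2 * x ^ 2 * p x) x) :
    ∫ x in a..b, (deriv v x * F x + v x * (s ^ 2 * x ^ 2 * p x)) = v b * F b - v a * F a := by
  have hFac : AbsolutelyContinuousOnInterval F a b := by
    obtain ⟨C, hC⟩ := isCompact_Icc.exists_bound_of_continuousOn
      (show ContinuousOn (fun x => s ^ 2 * x ^ 2 * p x) (Icc a b) by fun_prop)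
    have h := (convex_Icc a b).lipschitzOnWith_of_nnnorm_hasDerivWithin_le (f := F)
      (C := Real.toNNReal C) (fun x hx => (hF x hx).hasDerivWithinAt) (fun x hx => by
        rw [← NNReal.coe_le_coe, coe_nnnorm]
        exact (hC x hx).trans (Real.le_coe_toNNReal C))
    rw [← uIcc_of_le hab] at h
    exact h.absolutelyContinuousOnInterval
  rw [← (hv.2.1 a b ha hab).integral_deriv_mul_eq_sub hFac]
  refine intervalIntegral.integral_congr fun x hx => ?_
  rw [uIcc_of_le hab] at hx
  simp only [(hF x hx).deriv]

/-- A nonzero limit would make `1 / x` integrable near `0`. -/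
lemma eq_zero_of_tendsto_of_integrableOn_div {φ : ℝ → ℝ} {b L : ℝ} (hb : 0 < b)
    (h : IntegrableOn (fun x => φ x / x) (Ioc 0 b)) (hL : Tendsto φ (𝓝[>] 0) (𝓝 L)) : L = 0 := by
  by_contra hne
  have h1 : (fun _ : ℝ => (1 : ℝ)) =O[𝓝[>] 0] φ :=
    (Asymptotics.isBigO_const_left_iff_pos_le_norm one_ne_zero).2 ⟨‖L‖ / 2, by positivity,
      (hL.norm.eventually_const_le (half_lt_self (norm_pos_iff.2 hne)))⟩
  have h2 : (fun x : ℝ => x⁻¹) =O[𝓝[>] 0] fun x => φ x / x := by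
    simpa [div_eq_mul_inv] using h1.mul (Asymptotics.isBigO_refl (fun x : ℝ => x⁻¹) (𝓝[>] 0))
  have h3 : IntegrableAtFilter (fun x : ℝ => x⁻¹) (𝓝[>] 0) :=
    h2.integrableAtFilter (measurable_inv.stronglyMeasurable.stronglyMeasurableAtFilter)
      ⟨Ioc 0 b, Ioc_mem_nhdsGT hb, h⟩
  obtain ⟨S, hS, hint⟩ := h3
  obtain ⟨c, hc, hcS⟩ := mem_nhdsGT_iff_exists_Ioc_subset.1 hS
  have hc : 0 < c := hc
  have h4 : IntervalIntegrable (fun x : ℝ => x⁻¹) volume 0 c :=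
    (intervalIntegrable_iff_integrableOn_Ioc_of_le hc.le).2 (hint.mono_set hcS)
  rw [intervalIntegrable_inv_iff] at h4
  rcases h4 with h4 | h4
  · exact hc.ne h4
  · exact h4 left_mem_uIcc

/-- Integrate by parts on both sides of `y`: the two boundary terms at `y` combine to `v y` times
the unit flux jump. No pointwise bound on `v` at `0` or `∞` is used; there the boundary terms have
limits, and integrability forces these limits to vanish. -/
lemma besselForm_resolventKernel {s y : ℝ} (hs : 0 < s) (hy : 0 < y) {v : ℝ → ℝ}
    (hv : v ∈ besselDomain) : besselForm (s ^ 2 / 2) v (resolventKernel s y) = v y := by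
  have hG := resolventKernel_mem_besselDomain hs hy
  set ψ : ℝ → ℝ := fun x => deriv v x * resolventFlux s y x +
    v x * (s ^ 2 * x ^ 2 * resolventKernel s y x) with hψ
  have hae : (fun x => deriv v x * deriv (resolventKernel s y) x * x ^ 2 +
      s ^ 2 / 2 * (v x * resolventKernel s y x * (2 * x ^ 2))) =ᵐ[volume.restrict (Ioi 0)] ψ := by
    filter_upwards [ae_restrict_mem measurableSet_Ioi, ae_deriv_resolventKernel hs hy] with x hx h
    have hx : x ≠ 0 := ne_of_gt hx
    simp only [hψ, h]
    field_simp
  have hint : IntegrableOn ψ (Ioi 0) :=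
    ((integrableOn_deriv_mul_deriv hv hG).add ((integrableOn_mul_mul hv hG).const_mul _)).congr hae
  have hform : besselForm (s ^ 2 / 2) v (resolventKernel s y) = ∫ x in Ioi 0, ψ x := by
    rw [besselForm, ← integral_const_mul, ← integral_add (integrableOn_deriv_mul_deriv hv hG)
      ((integrableOn_mul_mul hv hG).const_mul _)]
    exact integral_congr_ae hae
  have hint₁ : IntegrableOn ψ (Ioc 0 y) := hint.mono_set Ioc_subset_Ioi_self
  have hint₂ : IntegrableOn ψ (Ioi y) := hint.mono_set (Ioi_subset_Ioi hy.le)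
  have hvx := memLp_mul_of_mem_besselDomain hv
  have hcv := continuousOn_of_mem_besselDomain hv
  -- the part on `(0, y]`
  have hI₁ : ∫ x in Ioc 0 y, ψ x = v y * innerFlux s y y := by
    have hstep : ∀ ε ∈ Ioc 0 y, v ε * innerFlux s y ε
        = v y * innerFlux s y y - ∫ x in ε..y, ψ x := by
      intro ε hε
      have h := integral_deriv_mul_add_of_solution (s := s) hv hε.1 hε.2
        (p := innerSolution s y) (F := innerFlux s y)
        (fun x hx => (hasDerivAt_innerSolution hs hy
          (hε.1.trans_le hx.1)).continuousAt.continuousWithinAt)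
        (fun x _ => hasDerivAt_innerFlux hs hy)
      have h' : ∫ x in ε..y, ψ x
          = ∫ x in ε..y, (deriv v x * innerFlux s y x + v x * (s ^ 2 * x ^ 2 * innerSolution s y x)) := by
        refine intervalIntegral.integral_congr fun x hx => ?_
        rw [uIcc_of_le hε.2] at hx
        simp only [hψ, resolventFlux, resolventKernel, if_pos hx.2,
          if_neg (not_le.2 (hε.1.trans_le hx.1))]
      rw [h', h]
      ring
    have hlim : Tendsto (fun ε => v ε * innerFlux s y ε) (𝓝[>] 0)
        (𝓝 (v y * innerFlux s y y - ∫ x in (0 : ℝ)..y, ψ x)) := by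
      have hc : ContinuousOn (fun ε => ∫ x in ε..y, ψ x) (uIcc 0 y) :=
        intervalIntegral.continuousOn_primitive_interval_left (by
          rw [uIcc_of_le hy.le, integrableOn_Icc_iff_integrableOn_Ioc]; exact hint₁)
      have hc0 : Tendsto (fun ε => ∫ x in ε..y, ψ x) (𝓝[>] 0) (𝓝 (∫ x in (0 : ℝ)..y, ψ x)) := by
        refine (hc 0 left_mem_uIcc).tendsto.mono_left ?_
        rw [uIcc_of_le hy.le, ← nhdsWithin_Ioc_eq_nhdsGT hy]
        exact nhdsWithin_mono _ Ioc_subset_Icc_self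
      refine (tendsto_const_nhds.sub hc0).congr' ?_
      filter_upwards [Ioc_mem_nhdsGT hy] with ε hε
      exact (hstep ε hε).symm
    -- The quotient by `ε` is integrable because the flux is `O(ε²)` and `v ε * ε` is square
    -- integrable, hence integrable on `(0, y]`.
    have hzero := eq_zero_of_tendsto_of_integrableOn_div hy (φ := fun ε => v ε * innerFlux s y ε)
      ?_ hlim
    · rw [intervalIntegral.integral_of_le hy.le] at hzero
      linarith
    · obtain ⟨K, hK, hKF⟩ := exists_abs_innerFlux_le hs hy
      have h1 : IntegrableOn (fun x => v x * x) (Ioc 0 y) :=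
        (hvx.mono_measure (Measure.restrict_mono_set volume Ioc_subset_Ioi_self)).integrable
          one_le_two
      refine Integrable.mono' (h1.abs.const_mul K) ?_ ?_
      · refine ContinuousOn.aestronglyMeasurable ?_ measurableSet_Ioc
        refine ContinuousOn.div ((hcv.mono Ioc_subset_Ioi_self).mul fun x _ =>
          (hasDerivAt_innerFlux hs hy).continuousAt.continuousWithinAt) continuousOn_id
          fun x hx => hx.1.ne'
      · filter_upwards [ae_restrict_mem measurableSet_Ioc] with x hx
        have hx0 : 0 < x := hx.1
        rw [Real.norm_eq_abs, abs_div, abs_mul, abs_mul, abs_of_pos hx0, div_le_iff₀ hx0]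
        calc |v x| * |innerFlux s y x| ≤ |v x| * (K * x ^ 2) := by
              gcongr; exact hKF x hx0.le hx.2
          _ = _ := by ring
  -- the part on `(y, ∞)`
  have hI₂ : ∫ x in Ioi y, ψ x = -(v y * outerFlux s y y) := by
    have hstep : ∀ R ∈ Ici y, v R * outerFlux s y R
        = v y * outerFlux s y y + ∫ x in y..R, ψ x := by
      intro R hR
      have hR : y ≤ R := hR
      have h := integral_deriv_mul_add_of_solution (s := s) hv hy hR
        (p := outerSolution s y) (F := outerFlux s y)
        (fun x hx => (hasDerivAt_outerSolution hs hy
          (hy.trans_le hx.1)).continuousAt.continuousWithinAt)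
        (fun x hx => hasDerivAt_outerFlux hs hy)
      have h' : ∫ x in y..R, ψ x
          = ∫ x in y..R, (deriv v x * outerFlux s y x + v x * (s ^ 2 * x ^ 2 * outerSolution s y x)) := by
        rw [intervalIntegral.integral_of_le hR, intervalIntegral.integral_of_le hR]
        refine setIntegral_congr_fun measurableSet_Ioc fun x hx => ?_
        simp only [hψ, resolventFlux, resolventKernel, if_neg (not_le.2 hx.1),
          if_neg (not_le.2 (hy.trans hx.1))]
      rw [h', h]
      ring
    have hlim : Tendsto (fun R => v R * outerFlux s y R) atTop
        (𝓝 (v y * outerFlux s y y + ∫ x in Ioi y, ψ x)) := by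
      refine (tendsto_const_nhds.add
        (intervalIntegral_tendsto_integral_Ioi y hint₂ tendsto_id)).congr' ?_
      filter_upwards [Ici_mem_atTop y] with R hR
      exact (hstep R hR).symm
    have hzero : v y * outerFlux s y y + ∫ x in Ioi y, ψ x = 0 := by
      -- Here the boundary term is itself integrable, as the product of the `L²` functions `v x * x`
      -- and flux over `x`.
      refine IntegrableAtFilter.eq_zero_of_tendsto (μ := volume)
        ⟨Ioi y, Ioi_mem_atTop y, ?_⟩ (fun S hS => ?_) hlim
      · obtain ⟨C, -, hC⟩ := exists_abs_resolventFlux_div_le hs hy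
        have h1 := (integrableOn_sq_of_abs_le_exp hs
          ((measurable_resolventFlux s y).div measurable_id) hC)
        have h2 := hvx.integrable_mul ((memLp_two_iff_integrable_sq
          ((measurable_resolventFlux s y).div measurable_id).aestronglyMeasurable).2 h1)
        refine IntegrableOn.congr_fun (h2.mono_measure
          (Measure.restrict_mono_set volume (Ioi_subset_Ioi hy.le))) (fun x hx => ?_)
          measurableSet_Ioi
        have hx : y < x := hx
        have hx0 : x ≠ 0 := (hy.trans hx).ne'
        simp only [Pi.mul_apply, Pi.div_apply, id, resolventFlux, if_neg (not_le.2 hx)]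
        field_simp
      · obtain ⟨c, hc⟩ := mem_atTop_sets.1 hS
        exact measure_mono_top (fun x hx => hc x hx) (Real.volume_Ici (a := c))
    linarith
  rw [hform, ← Ioc_union_Ioi_eq_Ioi hy.le, setIntegral_union (Ioc_disjoint_Ioi le_rfl)
    measurableSet_Ioi hint₁ hint₂, hI₁, hI₂]
  linear_combination v y * innerFlux_sub_outerFlux hs hy

/-! ### Finite sums of squares of functionals as quadratic forms -/

section SquareForm

variable {ι H : Type*} [NormedAddCommGroup H] [InnerProductSpace ℝ H]

/-- The quadratic form `u ↦ ∑_{i ∈ S} c i * (ℓ i u)²`. -/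
def squareForm (S : Finset ι) (c : ι → ℝ) (ℓ : ι → H →L[ℝ] ℝ) (u : H) : ℝ≥0∞ :=
  ENNReal.ofReal (∑ i ∈ S, c i * ℓ i u ^ 2)

variable {S : Finset ι} {c : ι → ℝ} {ℓ : ι → H →L[ℝ] ℝ}

lemma sum_mul_sq_nonneg (hc : ∀ i ∈ S, 0 ≤ c i) (u : H) : 0 ≤ ∑ i ∈ S, c i * ℓ i u ^ 2 :=
  Finset.sum_nonneg fun i hi => mul_nonneg (hc i hi) (sq_nonneg _)

lemma formDomain_squareForm : formDomain (squareForm S c ℓ) = univ :=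
  eq_univ_of_forall fun _ => ENNReal.ofReal_ne_top

lemma toReal_squareForm (hc : ∀ i ∈ S, 0 ≤ c i) (u : H) :
    (squareForm S c ℓ u).toReal = ∑ i ∈ S, c i * ℓ i u ^ 2 :=
  ENNReal.toReal_ofReal (sum_mul_sq_nonneg hc u)

lemma isQuadraticForm_squareForm (hc : ∀ i ∈ S, 0 ≤ c i) :
    IsQuadraticForm (squareForm S c ℓ) := by
  refine ⟨fun r u => ?_, fun u v => ?_⟩
  · rw [squareForm, squareForm, ← ENNReal.ofReal_mul (sq_nonneg r), Finset.mul_sum]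
    congr 1
    refine Finset.sum_congr rfl fun i _ => ?_
    rw [map_smul, smul_eq_mul]
    ring
  · have h2 : (2 : ℝ≥0∞) = ENNReal.ofReal 2 := by simp
    simp only [squareForm]
    rw [h2, ← ENNReal.ofReal_mul zero_le_two, ← ENNReal.ofReal_mul zero_le_two,
      ← ENNReal.ofReal_add (sum_mul_sq_nonneg hc _) (sum_mul_sq_nonneg hc _),
      ← ENNReal.ofReal_add (mul_nonneg zero_le_two (sum_mul_sq_nonneg hc _))
        (mul_nonneg zero_le_two (sum_mul_sq_nonneg hc _)), Finset.mul_sum, Finset.mul_sum,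
      ← Finset.sum_add_distrib, ← Finset.sum_add_distrib]
    congr 1
    refine Finset.sum_congr rfl fun i _ => ?_
    rw [map_add, map_sub]
    ring

lemma continuous_squareForm : Continuous (squareForm S c ℓ) := by
  exact ENNReal.continuous_ofReal.comp (by fun_prop)

lemma isClosedForm_squareForm : IsClosedForm (squareForm S c ℓ) := by
  refine fun u w _ hu _ => ⟨by rw [formDomain_squareForm]; trivial, ?_⟩
  have h : Tendsto (fun n => u n - w) atTop (𝓝 0) := by simpa using hu.sub_const w
  have h0 : squareForm S c ℓ 0 = 0 := by simp [squareForm]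
  exact h0 ▸ ((continuous_squareForm (S := S) (c := c) (ℓ := ℓ)).tendsto 0).comp h

lemma polarForm_squareForm (hc : ∀ i ∈ S, 0 ≤ c i) (u v : H) :
    polarForm (squareForm S c ℓ) u v = ∑ i ∈ S, c i * (ℓ i u * ℓ i v) := by
  rw [polarForm, toReal_squareForm hc, toReal_squareForm hc, ← Finset.sum_sub_distrib,
    Finset.sum_div]
  refine Finset.sum_congr rfl fun i _ => ?_
  rw [map_add, map_sub]
  ring

variable [CompleteSpace H]

/-- The operator associated with the form `u ↦ ∑_{i ∈ S} c i * (ℓ i u)²`. -/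
def squareOperator (S : Finset ι) (c : ι → ℝ) (ℓ : ι → H →L[ℝ] ℝ) : H →L[ℝ] H :=
  ∑ i ∈ S, c i • (ℓ i).smulRight ((InnerProductSpace.toDual ℝ H).symm (ℓ i))

lemma inner_squareOperator (hc : ∀ i ∈ S, 0 ≤ c i) (u v : H) :
    inner ℝ (squareOperator S c ℓ u) v = polarForm (squareForm S c ℓ) u v := by
  rw [polarForm_squareForm hc, squareOperator, sum_apply, sum_inner]
  refine Finset.sum_congr rfl fun i _ => ?_
  rw [smul_apply, ContinuousLinearMap.smulRight_apply, real_inner_smul_left,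
    real_inner_smul_left, InnerProductSpace.toDual_symm_apply]

lemma isFormOperator_squareForm_iff (hc : ∀ i ∈ S, 0 ≤ c i) (u g : H) :
    IsFormOperator (squareForm S c ℓ) u g ↔ g = squareOperator S c ℓ u := by
  simp only [IsFormOperator, formDomain_squareForm, mem_univ, true_and, forall_const,
    ← inner_squareOperator hc]
  exact ⟨fun h => ext_inner_right ℝ fun v => (h v).symm, fun h v => by rw [h]⟩

end SquareForm

/-! ### The semigroup of a bounded operator -/

section Semigroup

variable {H : Type*} [NormedAddCommGroup H] [InnerProductSpace ℝ H]

lemma hasDerivAt_exp_neg_smul_apply [CompleteSpace H] (A : H →L[ℝ] H) (f : H) (t : ℝ) :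
    HasDerivAt (fun t : ℝ => NormedSpace.exp (t • -A) f)
      (-A (NormedSpace.exp (t • -A) f)) t := by
  have h := (ContinuousLinearMap.apply ℝ H f).hasFDerivAt.comp_hasDerivAt t
    (hasDerivAt_exp_smul_const' (-A) t)
  exact h

/-- The derivative of `‖exp (-s A) f‖²` is `-2 ⟨A g, g⟩ ≤ 0` at `g = exp (-s A) f`. -/
lemma norm_exp_neg_smul_le_one [CompleteSpace H] {A : H →L[ℝ] H} (hA : ∀ u, 0 ≤ inner ℝ (A u) u)
    {t : ℝ} (ht : 0 ≤ t) : ‖NormedSpace.exp (t • -A)‖ ≤ 1 := by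
  refine ContinuousLinearMap.opNorm_le_bound _ zero_le_one fun f => ?_
  have hd : ∀ s : ℝ, HasDerivAt (fun s : ℝ => ‖NormedSpace.exp (s • -A) f‖ ^ 2)
      (2 * inner ℝ (NormedSpace.exp (s • -A) f) (-A (NormedSpace.exp (s • -A) f))) s :=
    fun s => (hasDerivAt_exp_neg_smul_apply A f s).norm_sq
  have hanti := antitone_of_deriv_nonpos (fun s => (hd s).differentiableAt) fun s => by
    rw [(hd s).deriv, inner_neg_right, real_inner_comm]
    linarith [hA (NormedSpace.exp (s • -A) f)]
  have h := hanti ht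
  simp only [zero_smul, NormedSpace.exp_zero, one_apply_eq_self] at h
  rw [one_mul]
  exact le_of_sq_le_sq h (norm_nonneg f)

lemma isFormSemigroup_exp [CompleteSpace H] {E : H → ℝ≥0∞} {A : H →L[ℝ] H}
    (hA : ∀ u, 0 ≤ inner ℝ (A u) u) (hEA : ∀ u g, IsFormOperator E u g ↔ g = A u) :
    IsFormSemigroup E fun t => NormedSpace.exp (t • -A) := by
  refine ⟨?_, fun s t _ _ => ?_, fun f => ?_, fun t ht => norm_exp_neg_smul_le_one hA ht, fun u g => ?_⟩
  · simp only [zero_smul, NormedSpace.exp_zero]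
    rfl
  · simp only
    rw [add_smul, NormedSpace.exp_add_of_commute_of_mem_ball (𝕂 := ℝ)]
    · rfl
    · exact ((Commute.refl (-A)).smul_left s).smul_right t
    · exact (NormedSpace.expSeries_radius_eq_top ℝ (H →L[ℝ] H)).symm ▸ edist_lt_top _ _
    · exact (NormedSpace.expSeries_radius_eq_top ℝ (H →L[ℝ] H)).symm ▸ edist_lt_top _ _
  · exact fun t _ => (hasDerivAt_exp_neg_smul_apply A f t).continuousAt.continuousWithinAt
  · rw [hEA]
    have h := (hasDerivAt_exp_neg_smul_apply A u 0).tendsto_slope_zero_right.neg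
    simp only [zero_add, zero_smul, NormedSpace.exp_zero, one_apply_eq_self, neg_neg,
      ← smul_neg, neg_sub] at h
    exact ⟨fun hg => hg ▸ h, fun hg => tendsto_nhds_unique hg h⟩

variable {E : H → ℝ≥0∞} {A : H →L[ℝ] H} {T : ℝ → H →L[ℝ] H}

lemma IsFormSemigroup.tendsto_generator (hT : IsFormSemigroup E T)
    (hEA : ∀ u g, IsFormOperator E u g ↔ g = A u) (u : H) :
    Tendsto (fun t : ℝ => t⁻¹ • (u - T t u)) (𝓝[>] 0) (𝓝 (A u)) :=
  (hT.2.2.2.2 u (A u)).1 ((hEA u (A u)).2 rfl)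

/-- Factoring `T s = T t ∘ T (s - t)` reduces the quotient at `t` to the one at `0`. A right
derivative is all that the generator provides directly, and it suffices for the fundamental theorem
of calculus. -/
lemma IsFormSemigroup.hasDerivWithinAt_Ioi (hT : IsFormSemigroup E T)
    (hEA : ∀ u g, IsFormOperator E u g ↔ g = A u) (u : H) {t : ℝ} (ht : 0 ≤ t) :
    HasDerivWithinAt (fun s => T s u) (-T t (A u)) (Ioi t) t := by
  rw [hasDerivWithinAt_iff_tendsto_slope' self_notMem_Ioi]
  have h1 := ((T t).continuous.tendsto _).comp (hT.tendsto_generator hEA u)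
  have h2 : Tendsto (fun s : ℝ => s - t) (𝓝[>] t) (𝓝[>] 0) := by
    refine tendsto_nhdsWithin_iff.2 ⟨?_, ?_⟩
    · have : Tendsto (fun s : ℝ => s - t) (𝓝 t) (𝓝 (t - t)) := (continuous_sub_right t).tendsto t
      rw [sub_self] at this
      exact this.mono_left nhdsWithin_le_nhds
    · filter_upwards [self_mem_nhdsWithin] with s hs
      exact sub_pos.2 (mem_Ioi.1 hs)
  refine ((h1.comp h2).neg).congr' ?_
  filter_upwards [self_mem_nhdsWithin] with s hs
  have hs : t < s := hs
  have h3 : T s u = T t (T (s - t) u) := by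
    have := hT.2.1 t (s - t) ht (sub_nonneg.2 hs.le)
    rw [add_sub_cancel] at this
    rw [this]
    rfl
  simp only [Function.comp_apply, slope_def_module, h3, map_smul, map_sub]
  rw [← smul_neg, neg_sub]

lemma IsFormSemigroup.integral_apply [CompleteSpace H] (hT : IsFormSemigroup E T)
    (hEA : ∀ u g, IsFormOperator E u g ↔ g = A u) (u : H) {M : ℝ} (hM : 0 ≤ M) :
    ∫ s in (0 : ℝ)..M, T s (A u) = u - T M u := by
  have hc : ∀ f, ContinuousOn (fun t => T t f) (Icc 0 M) := fun f =>
    (hT.2.2.1 f).mono Icc_subset_Ici_self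
  have h := intervalIntegral.integral_eq_sub_of_hasDeriv_right_of_le hM (hc u)
    (f' := fun t => -T t (A u)) (fun t ht => hT.hasDerivWithinAt_Ioi hEA u ht.1.le)
    (by
      refine ContinuousOn.intervalIntegrable ?_
      rw [uIcc_of_le hM]
      exact (hc _).neg)
  rw [intervalIntegral.integral_neg, hT.1] at h
  rw [← neg_neg (∫ s in (0 : ℝ)..M, T s (A u)), h]
  simp

lemma IsFormSemigroup.norm_integral_le [CompleteSpace H] (hT : IsFormSemigroup E T)
    (hEA : ∀ u g, IsFormOperator E u g ↔ g = A u) (u : H) {M : ℝ} (hM : 0 ≤ M) :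
    ‖∫ s in (0 : ℝ)..M, T s (A u)‖ ≤ 2 * ‖u‖ := by
  rw [hT.integral_apply hEA u hM]
  have h : ‖T M u‖ ≤ ‖u‖ := by
    simpa using (T M).le_of_opNorm_le (hT.2.2.2.1 M hM) u
  linarith [norm_sub_le u (T M u)]

/-- If `T t u = u`, contractivity forces `‖T s u‖ = ‖u‖` for `0 < s ≤ t`, that is, `⟨u - T s u, u +
T s u⟩ = 0`. Dividing by `s` and letting `s ↓ 0` gives `2 ⟨A u, u⟩ = 0`. -/
lemma IsFormSemigroup.apply_ne_self (hT : IsFormSemigroup E T)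
    (hEA : ∀ u g, IsFormOperator E u g ↔ g = A u) {u : H} (hu : inner ℝ (A u) u ≠ 0) {t : ℝ}
    (ht : 0 < t) : T t u ≠ u := by
  intro h
  have hle : ∀ s, 0 ≤ s → ∀ v, ‖T s v‖ ≤ ‖v‖ := fun s hs v => by
    simpa using (T s).le_of_opNorm_le (hT.2.2.2.1 s hs) v
  have hnorm : ∀ s ∈ Ioc 0 t, ‖T s u‖ = ‖u‖ := by
    intro s hs
    refine le_antisymm (hle s hs.1.le u) ?_
    have h1 := hT.2.1 (t - s) s (sub_nonneg.2 hs.2) hs.1.le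
    rw [sub_add_cancel] at h1
    have h2 : T (t - s) (T s u) = u := by
      rw [← ContinuousLinearMap.comp_apply, ← h1, h]
    calc ‖u‖ = ‖T (t - s) (T s u)‖ := by rw [h2]
      _ ≤ ‖T s u‖ := hle _ (sub_nonneg.2 hs.2) _
  have hcont : Tendsto (fun s => T s u) (𝓝[>] 0) (𝓝 u) := by
    have h1 := (hT.2.2.1 u 0 self_mem_Ici).tendsto.mono_left (nhdsWithin_mono 0 Ioi_subset_Ici_self)
    simpa [hT.1] using h1
  have hlim := (hT.tendsto_generator hEA u).inner (𝕜 := ℝ) (hcont.const_add u)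
  have hz : (fun s : ℝ => inner ℝ (s⁻¹ • (u - T s u)) (u + T s u)) =ᶠ[𝓝[>] 0] fun _ => (0 : ℝ) := by
    filter_upwards [Ioc_mem_nhdsGT ht] with s hs
    rw [real_inner_smul_left, real_inner_comm,
      (real_inner_add_sub_eq_zero_iff u (T s u)).2 (hnorm s hs).symm, mul_zero]
  have h0 := tendsto_nhds_unique (hlim.congr' hz) tendsto_const_nhds
  rw [inner_add_right] at h0
  exact hu (by linarith)

end Semigroup

/-! ### The Hilbert space `L²(μ)` of a finitely supported measure -/

section Atomic

variable {N : ℕ} {a : ℕ → ℝ}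

/-- All weights are positive, so a.e. means at every atom; in particular the values at the atoms do
not depend on the representative in `L²(μ)`. -/
lemma ae_atomicMeasure_iff (ha : ∀ k ∈ Finset.Icc 1 N, 0 < a k) {p : ℝ → Prop} :
    (∀ᵐ x ∂atomicMeasure N a, p x) ↔ ∀ k ∈ Finset.Icc 1 N, p (k : ℝ) := by
  rw [ae_iff, atomicMeasure, Measure.finsetSum_apply, Finset.sum_eq_zero_iff]
  refine forall₂_congr fun k hk => ?_
  rw [← ae_iff, Measure.ae_ennreal_smul_measure_iff (ENNReal.ofReal_pos.2 (ha k hk)).ne',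
    ae_dirac_eq, eventually_pure]

lemma integral_atomicMeasure (ha : ∀ k ∈ Finset.Icc 1 N, 0 < a k) (f : ℝ → ℝ) :
    ∫ x, f x ∂atomicMeasure N a = ∑ k ∈ Finset.Icc 1 N, a k * f k := by
  rw [atomicMeasure, integral_finsetSum_measure fun _ _ =>
    (integrable_dirac enorm_lt_top).smul_measure ENNReal.ofReal_ne_top]
  refine Finset.sum_congr rfl fun k hk => ?_
  rw [integral_smul_measure, integral_dirac, ENNReal.toReal_ofReal (ha k hk).le, smul_eq_mul]

lemma lintegral_atomicMeasure (f : ℝ → ℝ≥0∞) :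
    ∫⁻ x, f x ∂atomicMeasure N a = ∑ k ∈ Finset.Icc 1 N, ENNReal.ofReal (a k) * f k := by
  rw [atomicMeasure, lintegral_finsetSum_measure]
  refine Finset.sum_congr rfl fun k _ => ?_
  rw [lintegral_smul_measure, lintegral_dirac, smul_eq_mul]

lemma inner_atomicMeasure (ha : ∀ k ∈ Finset.Icc 1 N, 0 < a k)
    (u v : Lp ℝ 2 (atomicMeasure N a)) :
    inner ℝ u v = ∑ k ∈ Finset.Icc 1 N, a k * (u (k : ℝ) * v (k : ℝ)) := by
  rw [L2.inner_def, integral_atomicMeasure ha]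
  refine Finset.sum_congr rfl fun k _ => ?_
  rw [real_inner_comm]
  rfl

lemma ext_atomicMeasure (ha : ∀ k ∈ Finset.Icc 1 N, 0 < a k) {u v : Lp ℝ 2 (atomicMeasure N a)}
    (h : ∀ k ∈ Finset.Icc 1 N, u (k : ℝ) = v (k : ℝ)) : u = v :=
  Lp.ext ((ae_atomicMeasure_iff ha).2 h)

/-- The indicator function of `{k}` in `L²(μ)`. -/
def atomIndicator (N : ℕ) (a : ℕ → ℝ) (k : ℕ) : Lp ℝ 2 (atomicMeasure N a) :=
  indicatorConstLp 2 (measurableSet_singleton (k : ℝ)) (measure_ne_top _ _) 1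

lemma atomIndicator_apply (ha : ∀ k ∈ Finset.Icc 1 N, 0 < a k) (k : ℕ) {j : ℕ}
    (hj : j ∈ Finset.Icc 1 N) : atomIndicator N a k (j : ℝ) = if j = k then 1 else 0 := by
  have h := (ae_atomicMeasure_iff ha).1 (indicatorConstLp_coeFn (p := 2) (c := (1 : ℝ))
    (hs := measurableSet_singleton (k : ℝ)) (hμs := measure_ne_top (atomicMeasure N a) _)) j hj
  rw [atomIndicator, h]
  simp [indicator_apply]

/-- The evaluation functional `u ↦ u(k)` on `L²(μ)`, for `1 ≤ k ≤ N`. -/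
def coord (N : ℕ) (a : ℕ → ℝ) (k : ℕ) : Lp ℝ 2 (atomicMeasure N a) →L[ℝ] ℝ :=
  (a k)⁻¹ • innerSL ℝ (atomIndicator N a k)

lemma coord_apply (ha : ∀ k ∈ Finset.Icc 1 N, 0 < a k) {k : ℕ} (hk : k ∈ Finset.Icc 1 N)
    (u : Lp ℝ 2 (atomicMeasure N a)) : coord N a k u = u (k : ℝ) := by
  rw [coord, smul_apply, innerSL_apply_apply, inner_atomicMeasure ha,
    Finset.sum_eq_single_of_mem k hk fun j hj hjk => by
      rw [atomIndicator_apply ha k hj, if_neg hjk, zero_mul, mul_zero],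
    atomIndicator_apply ha k hk, if_pos rfl, one_mul, smul_eq_mul,
    inv_mul_cancel_left₀ (ha k hk).ne']

lemma exists_forall_coord_eq (ha : ∀ k ∈ Finset.Icc 1 N, 0 < a k) (c : ℕ → ℝ) :
    ∃ u : Lp ℝ 2 (atomicMeasure N a), ∀ k ∈ Finset.Icc 1 N, u (k : ℝ) = c k := by
  refine ⟨∑ j ∈ Finset.Icc 1 N, c j • atomIndicator N a j, fun k hk => ?_⟩
  rw [← coord_apply ha hk, map_sum, Finset.sum_eq_single_of_mem k hk fun j _ hjk => by
      rw [map_smul, coord_apply ha hk, atomIndicator_apply ha j hk, if_neg hjk.symm, smul_zero],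
    map_smul, coord_apply ha hk, atomIndicator_apply ha k hk, if_pos rfl, smul_eq_mul, mul_one]

lemma evalVector_apply (u : Lp ℝ 2 (atomicMeasure N a)) (i : Fin N) :
    evalVector u i = u (((i : ℕ) + 1 : ℕ) : ℝ) := by
  rw [evalVector]
  push_cast
  rfl

lemma fin_succ_mem_Icc (i : Fin N) : (i : ℕ) + 1 ∈ Finset.Icc 1 N :=
  Finset.mem_Icc.2 ⟨Nat.le_add_left _ _, i.2⟩

lemma forall_mem_Icc_iff_forall_fin {p : ℕ → Prop} :
    (∀ k ∈ Finset.Icc 1 N, p k) ↔ ∀ i : Fin N, p (i + 1) := by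
  refine ⟨fun h i => h _ (fin_succ_mem_Icc i), fun h k hk => ?_⟩
  obtain ⟨h1, h2⟩ := Finset.mem_Icc.1 hk
  have := h ⟨k - 1, by omega⟩
  simpa [Nat.sub_add_cancel h1] using this

lemma bijective_evalVector (ha : ∀ k ∈ Finset.Icc 1 N, 0 < a k) :
    Function.Bijective (evalVector : Lp ℝ 2 (atomicMeasure N a) → Fin N → ℝ) := by
  refine ⟨fun u v h => ext_atomicMeasure ha (forall_mem_Icc_iff_forall_fin.2 fun i => ?_),
    fun c => ?_⟩
  · rw [← evalVector_apply, ← evalVector_apply, h]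
  · obtain ⟨u, hu⟩ := exists_forall_coord_eq ha
      -- The atom `k` corresponds to the index `k - 1` of `Fin N`; the default value is never read
      -- on `1, …, N`.
      fun k => if h : k - 1 < N then c ⟨k - 1, h⟩ else 0
    refine ⟨u, funext fun i => ?_⟩
    rw [evalVector_apply, hu _ (fin_succ_mem_Icc i)]
    simp

lemma finiteDimensional_atomicMeasure (ha : ∀ k ∈ Finset.Icc 1 N, 0 < a k) :
    FiniteDimensional ℝ (Lp ℝ 2 (atomicMeasure N a)) := by
  refine FiniteDimensional.of_injective
    (LinearMap.pi fun i : Fin N => (coord N a (i + 1)).toLinearMap) fun u v h => ?_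
  refine ext_atomicMeasure ha (forall_mem_Icc_iff_forall_fin.2 fun i => ?_)
  rw [← coord_apply ha (fin_succ_mem_Icc i), ← coord_apply ha (fin_succ_mem_Icc i)]
  exact congrFun h i

/-! ### The jump form, the killing form, and their sum -/

lemma isDirichletForm_squareForm {ι : Type*} {S : Finset ι} {c : ι → ℝ}
    {ℓ : ι → Lp ℝ 2 (atomicMeasure N a) →L[ℝ] ℝ} (ha : ∀ k ∈ Finset.Icc 1 N, 0 < a k)
    (hc : ∀ i ∈ S, 0 ≤ c i)
    (h : ∀ i ∈ S, ∀ u v : Lp ℝ 2 (atomicMeasure N a),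
      (∀ k ∈ Finset.Icc 1 N, v (k : ℝ) = min (max (u (k : ℝ)) 0) 1) → |ℓ i v| ≤ |ℓ i u|) :
    IsDirichletForm (squareForm S c ℓ) := by
  refine ⟨isQuadraticForm_squareForm hc, by rw [formDomain_squareForm]; exact dense_univ,
    isClosedForm_squareForm, fun u v huv => ENNReal.ofReal_le_ofReal ?_⟩
  rw [ae_atomicMeasure_iff ha] at huv
  exact Finset.sum_le_sum fun i hi =>
    mul_le_mul_of_nonneg_left (sq_le_sq.2 (h i hi u v huv)) (hc i hi)

lemma abs_unitContraction_le (x : ℝ) : |min (max x 0) 1| ≤ |x| := by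
  grind

lemma abs_unitContraction_sub_le (x y : ℝ) :
    |min (max x 0) 1 - min (max y 0) 1| ≤ |x - y| := by
  grind

lemma besselJumpRate_nonneg (k j : ℕ) : 0 ≤ besselJumpRate k j := by
  unfold besselJumpRate
  split_ifs <;> positivity

lemma besselKillingRate_nonneg (k : ℕ) : 0 ≤ besselKillingRate N k := by
  unfold besselKillingRate
  split_ifs <;> positivity

lemma atomicJumpForm_eq_squareForm (ha : ∀ k ∈ Finset.Icc 1 N, 0 < a k) (b : ℕ → ℕ → ℝ) :
    (atomicJumpForm b : Lp ℝ 2 (atomicMeasure N a) → ℝ≥0∞) =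
      squareForm (Finset.Icc 1 N ×ˢ Finset.Icc 1 N) (fun p => b p.1 p.2)
        fun p => coord N a p.1 - coord N a p.2 := by
  ext u
  rw [atomicJumpForm, squareForm, Finset.sum_product]
  congr 1
  refine Finset.sum_congr rfl fun k hk => Finset.sum_congr rfl fun j hj => ?_
  rw [sub_apply, coord_apply ha hk, coord_apply ha hj]

lemma atomicKillingForm_eq_squareForm (ha : ∀ k ∈ Finset.Icc 1 N, 0 < a k) (κ : ℕ → ℝ) :
    (atomicKillingForm κ : Lp ℝ 2 (atomicMeasure N a) → ℝ≥0∞) =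
      squareForm (Finset.Icc 1 N) κ (coord N a) := by
  ext u
  rw [atomicKillingForm, squareForm]
  congr 1
  exact Finset.sum_congr rfl fun k hk => by rw [coord_apply ha hk]

lemma isDirichletForm_atomicJumpForm (ha : ∀ k ∈ Finset.Icc 1 N, 0 < a k) {b : ℕ → ℕ → ℝ}
    (hb : ∀ k j, 0 ≤ b k j) :
    IsDirichletForm (atomicJumpForm b : Lp ℝ 2 (atomicMeasure N a) → ℝ≥0∞) := by
  rw [atomicJumpForm_eq_squareForm ha]
  refine isDirichletForm_squareForm ha (fun p _ => hb p.1 p.2) fun p hp u v huv => ?_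
  obtain ⟨h1, h2⟩ := Finset.mem_product.1 hp
  rw [sub_apply, sub_apply, coord_apply ha h1, coord_apply ha h2, coord_apply ha h1,
    coord_apply ha h2, huv _ h1, huv _ h2]
  exact abs_unitContraction_sub_le _ _

lemma isDirichletForm_atomicKillingForm (ha : ∀ k ∈ Finset.Icc 1 N, 0 < a k) {κ : ℕ → ℝ}
    (hκ : ∀ k, 0 ≤ κ k) :
    IsDirichletForm (atomicKillingForm κ : Lp ℝ 2 (atomicMeasure N a) → ℝ≥0∞) := by
  rw [atomicKillingForm_eq_squareForm ha]
  refine isDirichletForm_squareForm ha (fun k _ => hκ k) fun k hk u v huv => ?_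
  rw [coord_apply ha hk, coord_apply ha hk, huv k hk]
  exact abs_unitContraction_le _

/-! ### The explicit trace energy and its representation as a sum of squares -/

/-- The quadratic polynomial `∑_{k=1}^{N-1} k (k + 1) (g_{k+1} - g_k)² + N g_N²`. -/
def traceEnergy (N : ℕ) (g : ℕ → ℝ) : ℝ :=
  (∑ k ∈ Finset.Ico 1 N, (k : ℝ) * ((k : ℝ) + 1) * (g (k + 1) - g k) ^ 2) + N * g N ^ 2

/-- One has `k (k+1) (g_{k+1} - g_k)² = ((k+1) g_{k+1} - k g_k)² - ((k+1) g_{k+1}² - k g_k²)`. The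
last brackets telescope, the killing term cancels the upper end, and the lower end `g_1²` is the
square with index `0`. -/
lemma traceEnergy_eq_sum_sq (g : ℕ → ℝ) (hN : 1 ≤ N) :
    traceEnergy N g = ∑ k ∈ Finset.range N, (((k : ℝ) + 1) * g (k + 1) - k * g k) ^ 2 := by
  induction N, hN using Nat.le_induction with
  | base => simp [traceEnergy]
  | succ n hn ih =>
    rw [Finset.sum_range_succ, ← ih, traceEnergy, traceEnergy, Finset.sum_Ico_succ_top hn]
    push_cast
    ring

/-- Each pair of neighbours occurs in both orders, which absorbs the factor `1/2` in the rate. -/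
lemma sum_besselJumpRate (N : ℕ) (g : ℕ → ℝ) :
    ∑ k ∈ Finset.Icc 1 N, ∑ j ∈ Finset.Icc 1 N, besselJumpRate k j * (g k - g j) ^ 2 =
      ∑ k ∈ Finset.Ico 1 N, (k : ℝ) * ((k : ℝ) + 1) * (g (k + 1) - g k) ^ 2 := by
  have h1 : ∀ k j, besselJumpRate k j * (g k - g j) ^ 2 =
      (if j = k + 1 then (k : ℝ) * j / 2 * (g k - g j) ^ 2 else 0) +
        if k = j + 1 then (j : ℝ) * k / 2 * (g j - g k) ^ 2 else 0 := by
    intro k j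
    unfold besselJumpRate
    split_ifs <;> first | omega | ring
  have h2 : ∑ k ∈ Finset.Icc 1 N, ∑ j ∈ Finset.Icc 1 N,
      (if j = k + 1 then (k : ℝ) * j / 2 * (g k - g j) ^ 2 else 0) =
      ∑ k ∈ Finset.Ico 1 N, (k : ℝ) * ((k : ℝ) + 1) / 2 * (g (k + 1) - g k) ^ 2 := by
    have h3 : Finset.Ico 1 N = (Finset.Icc 1 N).filter fun k => k + 1 ∈ Finset.Icc 1 N := by
      ext k
      simp only [Finset.mem_Ico, Finset.mem_filter, Finset.mem_Icc]
      omega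
    rw [h3, Finset.sum_filter]
    refine Finset.sum_congr rfl fun k _ => ?_
    rw [Finset.sum_ite_eq']
    split_ifs
    · push_cast; ring
    · rfl
  simp_rw [h1, Finset.sum_add_distrib]
  rw [Finset.sum_comm (f := fun k j : ℕ => if k = j + 1 then (j : ℝ) * k / 2 * (g j - g k) ^ 2 else 0),
    h2, ← Finset.sum_add_distrib]
  exact Finset.sum_congr rfl fun k _ => by ring

lemma sum_besselKillingRate (hN : 1 ≤ N) (g : ℕ → ℝ) :
    ∑ k ∈ Finset.Icc 1 N, besselKillingRate N k * g k ^ 2 = N * g N ^ 2 := by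
  rw [Finset.sum_eq_single_of_mem N (Finset.mem_Icc.2 ⟨hN, le_rfl⟩) fun k _ hk => by
    rw [besselKillingRate, if_neg hk, zero_mul], besselKillingRate, if_pos rfl]

/-- The trace form. -/
def traceForm (N : ℕ) (a : ℕ → ℝ) : Lp ℝ 2 (atomicMeasure N a) → ℝ≥0∞ :=
  squareForm (Finset.range N) 1 fun k => ((k : ℝ) + 1) • coord N a (k + 1) - (k : ℝ) • coord N a k

/-- Includes `k = 0`, which is not an atom: the factor `k` removes the meaningless value there. -/
lemma nat_mul_coord (ha : ∀ k ∈ Finset.Icc 1 N, 0 < a k) {k : ℕ} (hk : k ≤ N)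
    (u : Lp ℝ 2 (atomicMeasure N a)) : (k : ℝ) * coord N a k u = k * u (k : ℝ) := by
  rcases Nat.eq_zero_or_pos k with rfl | h
  · simp
  · rw [coord_apply ha (Finset.mem_Icc.2 ⟨h, hk⟩)]

lemma increment_apply (ha : ∀ k ∈ Finset.Icc 1 N, 0 < a k) {k : ℕ} (hk : k ∈ Finset.range N)
    (u : Lp ℝ 2 (atomicMeasure N a)) :
    (((k : ℝ) + 1) • coord N a (k + 1) - (k : ℝ) • coord N a k) u =
      ((k : ℝ) + 1) * u ((k + 1 : ℕ) : ℝ) - k * u (k : ℝ) := by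
  have hk := Finset.mem_range.1 hk
  rw [sub_apply, smul_apply, smul_apply, smul_eq_mul, smul_eq_mul, nat_mul_coord ha hk.le,
    coord_apply ha (Finset.mem_Icc.2 ⟨by omega, by omega⟩)]

lemma traceForm_eq (ha : ∀ k ∈ Finset.Icc 1 N, 0 < a k) (hN : 1 ≤ N)
    (u : Lp ℝ 2 (atomicMeasure N a)) :
    traceForm N a u = ENNReal.ofReal (traceEnergy N fun k => u (k : ℝ)) := by
  rw [traceForm, squareForm, traceEnergy_eq_sum_sq _ hN]
  congr 1
  refine Finset.sum_congr rfl fun k hk => ?_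
  rw [increment_apply ha hk, Pi.one_apply, one_mul]

lemma traceForm_eq_add (ha : ∀ k ∈ Finset.Icc 1 N, 0 < a k) (hN : 1 ≤ N)
    (u : Lp ℝ 2 (atomicMeasure N a)) :
    traceForm N a u = atomicJumpForm besselJumpRate u + atomicKillingForm (besselKillingRate N) u := by
  have h1 := sum_besselJumpRate N fun k => u (k : ℝ)
  have h2 := sum_besselKillingRate hN fun k => u (k : ℝ)
  rw [traceForm_eq ha hN, traceEnergy, atomicJumpForm, atomicKillingForm, h1, h2,
    ENNReal.ofReal_add (Finset.sum_nonneg fun k _ => by positivity) (by positivity)]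

/-- Closedness comes from the sum of squares, but the unit contraction need not decrease `|(k+1)
u_{k+1} - k u_k|`. The Markov property is therefore taken from the jump and killing parts. -/
lemma isDirichletForm_traceForm (ha : ∀ k ∈ Finset.Icc 1 N, 0 < a k) (hN : 1 ≤ N) :
    IsDirichletForm (traceForm N a) := by
  refine ⟨isQuadraticForm_squareForm fun _ _ => zero_le_one,
    by rw [traceForm, formDomain_squareForm]; exact dense_univ, isClosedForm_squareForm,
    fun u v huv => ?_⟩
  rw [traceForm_eq_add ha hN, traceForm_eq_add ha hN]
  exact add_le_add
    ((isDirichletForm_atomicJumpForm ha besselJumpRate_nonneg).2.2.2 u v huv)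
    ((isDirichletForm_atomicKillingForm ha besselKillingRate_nonneg).2.2.2 u v huv)

/-- `k g_k` is a sum of `k` increments, each bounded by the square root of the energy. -/
lemma abs_le_sqrt_traceEnergy (hN : 1 ≤ N) (g : ℕ → ℝ) {k : ℕ} (hk : k ∈ Finset.Icc 1 N) :
    |g k| ≤ √(traceEnergy N g) := by
  have hinc : ∀ k ∈ Finset.range N,
      |((k : ℝ) + 1) * g (k + 1) - k * g k| ≤ √(traceEnergy N g) := by
    intro k hk
    rw [traceEnergy_eq_sum_sq g hN]
    refine Real.abs_le_sqrt ?_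
    exact Finset.single_le_sum (f := fun k : ℕ => (((k : ℝ) + 1) * g (k + 1) - k * g k) ^ 2)
      (fun i _ => sq_nonneg _) hk
  have hsum : ∀ m ≤ N, |(m : ℝ) * g m| ≤ m * √(traceEnergy N g) := by
    intro m hm
    induction m with
    | zero => simp
    | succ m ih =>
      have h1 := hinc m (Finset.mem_range.2 hm)
      have h2 := ih (by omega)
      have h3 := abs_add_le (((m : ℝ) + 1) * g (m + 1) - m * g m) (m * g m)
      rw [sub_add_cancel] at h3
      push_cast
      linarith
  obtain ⟨h1, h2⟩ := Finset.mem_Icc.1 hk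
  have hk0 : (0 : ℝ) < k := by exact_mod_cast h1
  have h := hsum k h2
  rw [abs_mul, abs_of_pos hk0] at h
  exact le_of_mul_le_mul_left h hk0

lemma isTransientForm_traceForm (ha : ∀ k ∈ Finset.Icc 1 N, 0 < a k) (hN : 1 ≤ N) :
    IsTransientForm (traceForm N a) := by
  have hs : 0 < ∑ k ∈ Finset.Icc 1 N, a k :=
    Finset.sum_pos ha ⟨1, Finset.mem_Icc.2 ⟨le_rfl, hN⟩⟩
  set s := ∑ k ∈ Finset.Icc 1 N, a k
  -- Dividing by the total mass `s` turns `∫ |u| g dμ` into a weighted mean of the `|u_k|`, each at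
  -- most `E[u]^{1/2}`.
  refine ⟨fun _ => s⁻¹, measurable_const, ⟨|s⁻¹|, fun _ => le_rfl⟩, integrable_const _,
    Eventually.of_forall fun _ => inv_pos.2 hs, fun u _ => ?_⟩
  have hE : traceForm N a u ^ (1 / 2 : ℝ) =
      ENNReal.ofReal √(traceEnergy N fun k => u (k : ℝ)) := by
    rw [traceForm_eq ha hN, ENNReal.ofReal_rpow_of_nonneg (by unfold traceEnergy; positivity)
      (by norm_num), Real.sqrt_eq_rpow]
  rw [hE, lintegral_atomicMeasure]
  set e := √(traceEnergy N fun k => u (k : ℝ))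
  calc ∑ k ∈ Finset.Icc 1 N, ENNReal.ofReal (a k) * ENNReal.ofReal (|u (k : ℝ)| * s⁻¹)
      ≤ ∑ k ∈ Finset.Icc 1 N, ENNReal.ofReal (a k * (e * s⁻¹)) := by
        refine Finset.sum_le_sum fun k hk => ?_
        rw [← ENNReal.ofReal_mul (ha k hk).le]
        refine ENNReal.ofReal_le_ofReal (mul_le_mul_of_nonneg_left ?_ (ha k hk).le)
        exact mul_le_mul_of_nonneg_right
          (abs_le_sqrt_traceEnergy hN (fun k => u (k : ℝ)) hk) (inv_pos.2 hs).le
    _ = ENNReal.ofReal (s * (e * s⁻¹)) := by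
        rw [← ENNReal.ofReal_sum_of_nonneg fun k hk => mul_nonneg (ha k hk).le (by positivity),
          ← Finset.sum_mul]
    _ = ENNReal.ofReal e := by
        congr 1
        field_simp

/-! ### The semigroup of the trace form -/

/-- The operator associated with the trace form. -/
def traceOperator (N : ℕ) (a : ℕ → ℝ) : Lp ℝ 2 (atomicMeasure N a) →L[ℝ] Lp ℝ 2 (atomicMeasure N a) :=
  squareOperator (Finset.range N) 1
    fun k => ((k : ℝ) + 1) • coord N a (k + 1) - (k : ℝ) • coord N a k

lemma isFormOperator_traceForm_iff (u g : Lp ℝ 2 (atomicMeasure N a)) :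
    IsFormOperator (traceForm N a) u g ↔ g = traceOperator N a u :=
  isFormOperator_squareForm_iff (fun _ _ => zero_le_one) u g

lemma inner_traceOperator (ha : ∀ k ∈ Finset.Icc 1 N, 0 < a k)
    (u v : Lp ℝ 2 (atomicMeasure N a)) :
    inner ℝ (traceOperator N a u) v = ∑ k ∈ Finset.range N,
      (((k : ℝ) + 1) * u ((k + 1 : ℕ) : ℝ) - k * u (k : ℝ)) *
        (((k : ℝ) + 1) * v ((k + 1 : ℕ) : ℝ) - k * v (k : ℝ)) := by
  rw [traceOperator, inner_squareOperator (c := 1) (fun _ _ => zero_le_one),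
    polarForm_squareForm (c := 1) (fun _ _ => zero_le_one)]
  refine Finset.sum_congr rfl fun k hk => ?_
  rw [increment_apply ha hk, increment_apply ha hk, Pi.one_apply, one_mul]

lemma inner_traceOperator_self (ha : ∀ k ∈ Finset.Icc 1 N, 0 < a k) (hN : 1 ≤ N)
    (u : Lp ℝ 2 (atomicMeasure N a)) :
    inner ℝ (traceOperator N a u) u = traceEnergy N fun k => u (k : ℝ) := by
  rw [inner_traceOperator ha, traceEnergy_eq_sum_sq _ hN]
  exact Finset.sum_congr rfl fun k _ => (pow_two _).symm

/-- `L u = 0` gives zero energy, hence `u = 0`; in finite dimension injectivity implies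
surjectivity. -/
lemma surjective_traceOperator (ha : ∀ k ∈ Finset.Icc 1 N, 0 < a k) (hN : 1 ≤ N) :
    Function.Surjective (traceOperator N a) := by
  have := finiteDimensional_atomicMeasure ha
  refine (LinearMap.injective_iff_surjective (f := (traceOperator N a).toLinearMap)).1 ?_
  refine (injective_iff_map_eq_zero _).2 fun u hu => ext_atomicMeasure ha fun k hk => ?_
  have h0 : traceOperator N a u = 0 := hu
  have h1 := inner_traceOperator_self ha hN u
  rw [h0, inner_zero_left] at h1
  have h2 := abs_le_sqrt_traceEnergy hN (fun k => u (k : ℝ)) hk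
  rw [← h1, Real.sqrt_zero, abs_nonpos_iff] at h2
  rw [h2, (ae_atomicMeasure_iff ha).1 (Lp.coeFn_zero ℝ 2 (atomicMeasure N a)) k hk]
  rfl

lemma isFormSemigroup_traceForm (ha : ∀ k ∈ Finset.Icc 1 N, 0 < a k) (hN : 1 ≤ N) :
    IsFormSemigroup (traceForm N a) fun t => NormedSpace.exp (t • -traceOperator N a) :=
  isFormSemigroup_exp (fun u => by
    rw [inner_traceOperator_self ha hN]; unfold traceEnergy; positivity)
    isFormOperator_traceForm_iff

/-! ### Transience, irreducibility and failure of conservativeness for the semigroup -/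

variable {T : ℝ → Lp ℝ 2 (atomicMeasure N a) →L[ℝ] Lp ℝ 2 (atomicMeasure N a)}

/-- Writing `f = L g`, the potential up to time `M` is `g - T M g`, of norm at most `2 ‖g‖`;
evaluations at atoms are bounded functionals. -/
lemma isTransientSemigroup_of_traceForm (ha : ∀ k ∈ Finset.Icc 1 N, 0 < a k) (hN : 1 ≤ N)
    (hT : IsFormSemigroup (traceForm N a) T) : IsTransientSemigroup T := by
  intro f _ _
  obtain ⟨g, rfl⟩ := surjective_traceOperator ha hN f
  have hbound : ∀ k ∈ Finset.Icc 1 N, ∀ u : Lp ℝ 2 (atomicMeasure N a),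
      u (k : ℝ) ≤ (∑ j ∈ Finset.Icc 1 N, ‖coord N a j‖) * ‖u‖ := by
    intro k hk u
    rw [← coord_apply ha hk]
    calc coord N a k u ≤ ‖coord N a k u‖ := Real.le_norm_self _
      _ ≤ ‖coord N a k‖ * ‖u‖ := (coord N a k).le_opNorm u
      _ ≤ _ := mul_le_mul_of_nonneg_right
        (Finset.single_le_sum (f := fun j => ‖coord N a j‖) (fun j _ => norm_nonneg _) hk)
        (norm_nonneg u)
  refine ⟨fun _ => (∑ j ∈ Finset.Icc 1 N, ‖coord N a j‖) * (2 * ‖g‖), fun M hM => ?_⟩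
  refine (ae_atomicMeasure_iff ha).2 fun k hk => (hbound k hk _).trans ?_
  exact mul_le_mul_of_nonneg_left (hT.norm_integral_le isFormOperator_traceForm_iff g hM)
    (Finset.sum_nonneg fun j _ => norm_nonneg _)

/-- By invariance `T t 1_j` vanishes off `A`, in particular at `k`, for every `t > 0`.
Differentiating at `t = 0` shows that `L 1_j` vanishes at `k`. -/
lemma inner_traceOperator_eq_zero_of_isInvariantSet (ha : ∀ k ∈ Finset.Icc 1 N, 0 < a k)
    (hT : IsFormSemigroup (traceForm N a) T) {A : Set ℝ} (hA : IsInvariantSet T A) {j k : ℕ}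
    (hj : j ∈ Finset.Icc 1 N) (hk : k ∈ Finset.Icc 1 N) (hjA : (j : ℝ) ∈ A) (hkA : (k : ℝ) ∉ A) :
    inner ℝ (traceOperator N a (atomIndicator N a j)) (atomIndicator N a k) = 0 := by
  have hjk : k ≠ j := by rintro rfl; exact hkA hjA
  have hind : (atomIndicator N a j : ℝ → ℝ) =ᵐ[atomicMeasure N a]
      A.indicator (atomIndicator N a j) := by
    refine (ae_atomicMeasure_iff ha).2 fun i hi => ?_
    rcases eq_or_ne i j with rfl | hij
    · rw [indicator_of_mem hjA]
    · refine (indicator_apply_eq_self.2 fun _ => ?_).symm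
      rw [atomIndicator_apply ha j hi, if_neg hij]
  have hzero : ∀ t : ℝ, 0 < t → coord N a k (T t (atomIndicator N a j)) = 0 := fun t ht => by
    rw [coord_apply ha hk, (ae_atomicMeasure_iff ha).1 (hA.2 t ht _ _ hind) k hk,
      indicator_of_notMem hkA]
  have hlim := ((coord N a k).continuous.tendsto _).comp
    (hT.tendsto_generator isFormOperator_traceForm_iff (atomIndicator N a j))
  have hL : coord N a k (traceOperator N a (atomIndicator N a j)) = 0 := by
    refine tendsto_nhds_unique (hlim.congr' ?_) tendsto_const_nhds
    filter_upwards [self_mem_nhdsWithin] with t ht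
    rw [Function.comp_apply, map_smul, map_sub, hzero t ht, coord_apply ha hk,
      atomIndicator_apply ha j hk, if_neg hjk, sub_zero, smul_zero]
  rw [inner_atomicMeasure ha]
  refine Finset.sum_eq_zero fun i hi => ?_
  rw [atomIndicator_apply ha k hi]
  split_ifs with h
  · rw [h, ← coord_apply ha hk, hL, zero_mul, mul_zero]
  · rw [mul_zero, mul_zero]

/-- Only the increment from `k` to `k + 1` involves both atoms, and it contributes `-k (k + 1)`. -/
lemma inner_traceOperator_atomIndicator_succ (ha : ∀ k ∈ Finset.Icc 1 N, 0 < a k) {k : ℕ}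
    (hk : 1 ≤ k) (hkN : k + 1 ≤ N) :
    inner ℝ (traceOperator N a (atomIndicator N a k)) (atomIndicator N a (k + 1)) ≠ 0 := by
  have hval : ∀ i j : ℕ, j ≤ N →
      (j : ℝ) * atomIndicator N a i (j : ℝ) = if j = i then (j : ℝ) else 0 := by
    intro i j hj
    rcases Nat.eq_zero_or_pos j with rfl | h
    · simp
    · rw [atomIndicator_apply ha i (Finset.mem_Icc.2 ⟨h, hj⟩), mul_ite, mul_one, mul_zero]
  have hval' : ∀ i j : ℕ, j + 1 ≤ N →
      ((j : ℝ) + 1) * atomIndicator N a i ((j + 1 : ℕ) : ℝ) =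
        if j + 1 = i then (j : ℝ) + 1 else 0 := by
    intro i j hj
    have := hval i (j + 1) hj
    push_cast at this ⊢
    exact this
  rw [inner_traceOperator ha, Finset.sum_eq_single_of_mem k (Finset.mem_range.2 hkN)]
  · rw [hval' _ _ hkN, hval' _ _ hkN, hval _ _ (by omega), hval _ _ (by omega)]
    have h0 : (0 : ℝ) < k := by exact_mod_cast hk
    have : (0 : ℝ) < k * (k + 1) := by positivity
    simp only [Nat.succ_ne_self, if_false, if_true, (Nat.succ_ne_self k).symm]
    linarith
  · intro i hi hik
    have hi := Finset.mem_range.1 hi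
    rw [hval' _ _ hi, hval' _ _ hi, hval _ _ hi.le, hval _ _ hi.le]
    rcases eq_or_ne i (k + 1) with rfl | h
    · simp [show ¬ k + 1 + 1 = k by omega]
    · simp [h, hik]

lemma isIrreducibleSemigroup_of_traceForm (ha : ∀ k ∈ Finset.Icc 1 N, 0 < a k)
    (hT : IsFormSemigroup (traceForm N a) T) : IsIrreducibleSemigroup T := by
  intro A hA
  have hstep : ∀ k, 1 ≤ k → k + 1 ≤ N → ((k : ℝ) ∈ A ↔ ((k + 1 : ℕ) : ℝ) ∈ A) := by
    intro k hk hkN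
    have h1 : k ∈ Finset.Icc 1 N := Finset.mem_Icc.2 ⟨hk, by omega⟩
    have h2 : k + 1 ∈ Finset.Icc 1 N := Finset.mem_Icc.2 ⟨by omega, hkN⟩
    have hne := inner_traceOperator_atomIndicator_succ ha hk hkN
    by_contra hcon
    by_cases h : (k : ℝ) ∈ A
    · exact hne (inner_traceOperator_eq_zero_of_isInvariantSet ha hT hA h1 h2 h
        fun h' => hcon ⟨fun _ => h', fun _ => h⟩)
    · have h' : ((k + 1 : ℕ) : ℝ) ∈ A := by tauto
      refine hne ?_
      -- When only `k + 1` lies in `A`, the roles are exchanged by the symmetry of `L`.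
      rw [← inner_traceOperator_eq_zero_of_isInvariantSet ha hT hA h2 h1 h' h,
        inner_traceOperator ha, inner_traceOperator ha]
      exact Finset.sum_congr rfl fun i _ => mul_comm _ _
  have hall : ∀ k ∈ Finset.Icc 1 N, ((k : ℝ) ∈ A ↔ ((1 : ℕ) : ℝ) ∈ A) := by
    intro k hk
    obtain ⟨h1, h2⟩ := Finset.mem_Icc.1 hk
    clear hk
    induction k, h1 using Nat.le_induction with
    | base => rfl
    | succ k hk ih => exact (hstep k hk h2).symm.trans (ih (by omega))
  by_cases h : ((1 : ℕ) : ℝ) ∈ A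
  · exact Or.inr ((ae_atomicMeasure_iff ha (p := fun x => x ∈ A)).2 fun k hk => (hall k hk).2 h)
  · left
    have := (ae_atomicMeasure_iff ha (p := fun x => x ∉ A)).2 fun k hk => mt (hall k hk).1 h
    simpa [ae_iff] using this

/-- The jump part vanishes on constants, so `⟨L 1, 1⟩` is the killing term `N ≠ 0`. -/
lemma not_isConservativeSemigroup_of_traceForm (ha : ∀ k ∈ Finset.Icc 1 N, 0 < a k) (hN : 1 ≤ N)
    (hT : IsFormSemigroup (traceForm N a) T) : ¬ IsConservativeSemigroup T := by
  rintro ⟨t, ht, h⟩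
  refine hT.apply_ne_self isFormOperator_traceForm_iff ?_ ht h
  have h1 : ∀ k ∈ Finset.Icc 1 N, Lp.const 2 (atomicMeasure N a) (1 : ℝ) (k : ℝ) = 1 :=
    (ae_atomicMeasure_iff ha).1 (Lp.coeFn_const 2 (atomicMeasure N a) (1 : ℝ))
  rw [inner_traceOperator_self ha hN, traceEnergy, Finset.sum_eq_zero fun k hk => ?_,
    h1 N (Finset.mem_Icc.2 ⟨hN, le_rfl⟩)]
  · have : (0 : ℝ) < N := by exact_mod_cast hN
    simp [this.ne']
  · obtain ⟨h2, h3⟩ := Finset.mem_Ico.1 hk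
    rw [h1 k (Finset.mem_Icc.2 ⟨h2, h3.le⟩), h1 (k + 1) (Finset.mem_Icc.2 ⟨by omega, h3⟩)]
    simp

end Atomic

/-! ### The Green matrix -/

section Trace

variable {N : ℕ} {a : ℕ → ℝ}

/-- The matrix of values of the resolvent kernel at the points `1, …, N`. -/
def resolventMatrix (N : ℕ) (s : ℝ) : Matrix (Fin N) (Fin N) ℝ :=
  Matrix.of fun i j => resolventKernel s ((i + 1 : ℕ) : ℝ) ((j + 1 : ℕ) : ℝ)

/-- The matrix of values of the Green function `1 / max x y` at the points `1, …, N`. -/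
def greenMatrix (N : ℕ) : Matrix (Fin N) (Fin N) ℝ :=
  Matrix.of fun i j => (max ((j + 1 : ℕ) : ℝ) ((i + 1 : ℕ) : ℝ))⁻¹

lemma tendsto_sinh_mul_div (x : ℝ) :
    Tendsto (fun s : ℝ => Real.sinh (s * x) / s) (𝓝[>] 0) (𝓝 x) := by
  have h : HasDerivAt (fun s : ℝ => Real.sinh (s * x)) x 0 := by
    simpa using ((hasDerivAt_id (0 : ℝ)).mul_const x).sinh
  simpa [div_eq_inv_mul] using h.tendsto_slope_zero_right

lemma tendsto_exp_neg_mul (x : ℝ) :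
    Tendsto (fun s : ℝ => Real.exp (-s * x)) (𝓝[>] 0) (𝓝 1) := by
  have h : Continuous fun s : ℝ => Real.exp (-s * x) := by fun_prop
  simpa using (h.tendsto 0).mono_left nhdsWithin_le_nhds

lemma tendsto_resolventKernel {x y : ℝ} (hx : 0 < x) (hy : 0 < y) :
    Tendsto (fun s => resolventKernel s y x) (𝓝[>] 0) (𝓝 (max x y)⁻¹) := by
  simp only [resolventKernel, if_neg (not_le.2 hx)]
  rcases le_or_gt x y with h | h
  · have := ((tendsto_exp_neg_mul y).mul (tendsto_sinh_mul_div x)).div_const (y * x)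
    rw [one_mul, show x / (y * x) = y⁻¹ by field_simp] at this
    simp only [if_pos h, max_eq_right h, innerSolution]
    refine this.congr fun s => ?_
    ring
  · have := ((tendsto_exp_neg_mul x).mul (tendsto_sinh_mul_div y)).div_const (y * x)
    rw [one_mul, show y / (y * x) = x⁻¹ by field_simp] at this
    simp only [if_neg (not_le.2 h), max_eq_left h.le, outerSolution]
    refine this.congr fun s => ?_
    ring

lemma tendsto_resolventMatrix (N : ℕ) :
    Tendsto (resolventMatrix N) (𝓝[>] 0) (𝓝 (greenMatrix N)) :=
  tendsto_pi_nhds.2 fun i => tendsto_pi_nhds.2 fun j =>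
    tendsto_resolventKernel (by positivity) (by positivity)

/-- Summation by parts: for `k ≤ i` the maximum is constant and the weights `k + 1` produce a sum of
the `δ k`; for `k > i` the weight cancels the maximum and the differences telescope. -/
lemma sum_range_mul_sub_div_max (δ : ℕ → ℝ) (i : ℕ) {n : ℕ} (hn : i + 1 ≤ n) :
    ∑ k ∈ Finset.range n, ((k : ℝ) + 1) * (δ k - δ (k + 1)) *
      (max ((i + 1 : ℕ) : ℝ) ((k + 1 : ℕ) : ℝ))⁻¹ =
      (∑ k ∈ Finset.range (i + 1), δ k) / ((i : ℝ) + 1) - δ n := by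
  have hlow : ∀ m ≤ i + 1, ∑ k ∈ Finset.range m, ((k : ℝ) + 1) * (δ k - δ (k + 1)) *
      (max ((i + 1 : ℕ) : ℝ) ((k + 1 : ℕ) : ℝ))⁻¹ =
      ((∑ k ∈ Finset.range m, δ k) - m * δ m) / ((i : ℝ) + 1) := by
    intro m hm
    induction m with
    | zero => simp
    | succ m ih =>
      rw [Finset.sum_range_succ, ih (by omega), Finset.sum_range_succ,
        max_eq_left (by exact_mod_cast hm)]
      push_cast
      field_simp
      ring
  induction n, hn using Nat.le_induction with
  | base =>
    rw [hlow _ le_rfl]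
    push_cast
    field_simp
  | succ n hn ih =>
    rw [Finset.sum_range_succ, ih, max_eq_right (by exact_mod_cast (by omega : i + 1 ≤ n + 1))]
    push_cast
    field_simp
    ring

/-- The charge `d` generating the potential `g` is minus the second difference of `k g_k`, weighted
by `k`. Having `d` explicitly gives both invertibility and the inverse quadratic form. -/
lemma exists_vecMul_greenMatrix (hN : 1 ≤ N) (g : ℕ → ℝ) :
    ∃ d : Fin N → ℝ, Matrix.vecMul d (greenMatrix N) = (fun i : Fin N => g (i + 1)) ∧
      d ⬝ᵥ (fun i : Fin N => g (i + 1)) = traceEnergy N g := by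
  -- Cutting off at `N` corresponds to `k g_k` being constant beyond `N`, that is, to the harmonic
  -- extension decaying like `1 / x`.
  set δ : ℕ → ℝ := fun k => if k < N then ((k : ℝ) + 1) * g (k + 1) - k * g k else 0 with hδ
  have hδN : δ N = 0 := if_neg (lt_irrefl N)
  have hsum : ∀ m ≤ N, ∑ k ∈ Finset.range m, δ k = m * g m := by
    intro m hm
    induction m with
    | zero => simp
    | succ m ih =>
      rw [Finset.sum_range_succ, ih (by omega), hδ]
      simp only [if_pos (show m < N by omega)]
      push_cast
      ring
  have hsq : ∀ m ≤ N, ∑ k ∈ Finset.range m, ((k : ℝ) + 1) * (δ k - δ (k + 1)) * g (k + 1) =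
      (∑ k ∈ Finset.range m, δ k ^ 2) - m * g m * δ m := by
    intro m hm
    induction m with
    | zero => simp
    | succ m ih =>
      have h : δ m = ((m : ℝ) + 1) * g (m + 1) - m * g m := if_pos (by omega)
      rw [Finset.sum_range_succ, ih (by omega), Finset.sum_range_succ]
      push_cast
      linear_combination (-δ m) * h
  refine ⟨fun i => (((i : ℕ) : ℝ) + 1) * (δ i - δ (i + 1)), funext fun i => ?_, ?_⟩
  · rw [Matrix.vecMul, dotProduct]
    simp only [greenMatrix, Matrix.of_apply]
    rw [Fin.sum_univ_eq_sum_range (fun k : ℕ => ((k : ℝ) + 1) * (δ k - δ (k + 1)) *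
      (max ((i + 1 : ℕ) : ℝ) ((k + 1 : ℕ) : ℝ))⁻¹) N, sum_range_mul_sub_div_max δ i i.2, hδN,
      hsum _ i.2]
    push_cast
    field_simp
    ring
  · rw [dotProduct, Fin.sum_univ_eq_sum_range
      (fun k : ℕ => ((k : ℝ) + 1) * (δ k - δ (k + 1)) * g (k + 1)) N, hsq N le_rfl, hδN, mul_zero,
      sub_zero, traceEnergy_eq_sum_sq g hN]
    refine Finset.sum_congr rfl fun k hk => ?_
    simp only [hδ, if_pos (Finset.mem_range.1 hk)]

lemma isUnit_greenMatrix (hN : 1 ≤ N) : IsUnit (greenMatrix N) := by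
  refine Matrix.vecMul_surjective_iff_isUnit.1 fun f => ?_
  obtain ⟨d, hd, -⟩ := exists_vecMul_greenMatrix hN
    fun k => if h : k - 1 < N then f ⟨k - 1, h⟩ else 0
  refine ⟨d, hd.trans (funext fun i => ?_)⟩
  simp

lemma vecMul_inv_greenMatrix_dotProduct (hN : 1 ≤ N) (u : Lp ℝ 2 (atomicMeasure N a)) :
    Matrix.vecMul (evalVector u) (greenMatrix N)⁻¹ ⬝ᵥ evalVector u =
      traceEnergy N fun k => u (k : ℝ) := by
  have hu : evalVector u = fun i : Fin N => u (((i : ℕ) + 1 : ℕ) : ℝ) := funext (evalVector_apply u)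
  obtain ⟨d, hd, hdu⟩ := exists_vecMul_greenMatrix hN fun k => u (k : ℝ)
  rw [← hdu, hu, ← hd, Matrix.vecMul_vecMul,
    Matrix.mul_nonsing_inv _ ((Matrix.isUnit_iff_isUnit_det _).1 (isUnit_greenMatrix hN)),
    Matrix.vecMul_one]

/-! ### The approximating forms -/

lemma isRestriction_atomicMeasure_iff (ha : ∀ k ∈ Finset.Icc 1 N, 0 < a k) {u : ℝ → ℝ}
    {f : Lp ℝ 2 (atomicMeasure N a)} :
    IsRestriction (atomicMeasure N a) u f ↔
      u ∈ besselDomain ∧ ∀ i : Fin N, u (((i : ℕ) + 1 : ℕ) : ℝ) = evalVector f i := by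
  simp only [evalVector_apply]
  rw [IsRestriction, EventuallyEq, ae_atomicMeasure_iff ha,
    forall_mem_Icc_iff_forall_fin (p := fun k => u (k : ℝ) = f (k : ℝ))]

lemma mem_restrictionKernel_atomicMeasure_iff (ha : ∀ k ∈ Finset.Icc 1 N, 0 < a k) {u : ℝ → ℝ} :
    u ∈ restrictionKernel (atomicMeasure N a) ↔
      u ∈ besselDomain ∧ ∀ i : Fin N, u (((i : ℕ) + 1 : ℕ) : ℝ) = 0 := by
  refine (isRestriction_atomicMeasure_iff ha).trans (and_congr_right fun _ => forall_congr' fun i => ?_)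
  rw [evalVector_apply, (ae_atomicMeasure_iff ha).1 (Lp.coeFn_zero ℝ 2 (atomicMeasure N a)) _
    (fin_succ_mem_Icc i)]
  rfl

/-- The interpolating combination `w` of kernels is its own projection and has energy `c ⬝ᵥ f`.
Conversely, let `p` be any projection of some `u` with `J u = f`. Then `u - p` is orthogonal to the
kernels, so `p` has the values `f`; thus `p - w ∈ ker J` and `B p p = B p w = c ⬝ᵥ f`. No uniqueness
of projections is needed. -/
lemma approxTrace_atomicMeasure (ha : ∀ k ∈ Finset.Icc 1 N, 0 < a k) {s : ℝ} (hs : 0 < s)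
    (hM : IsUnit (resolventMatrix N s)) (f : Lp ℝ 2 (atomicMeasure N a)) :
    approxTrace (atomicMeasure N a) (s ^ 2 / 2) f =
      ENNReal.ofReal (Matrix.vecMul (evalVector f) (resolventMatrix N s)⁻¹ ⬝ᵥ evalVector f) := by
  set c := Matrix.vecMul (evalVector f) (resolventMatrix N s)⁻¹ with hc
  have hcM : Matrix.vecMul c (resolventMatrix N s) = evalVector f := by
    rw [hc, Matrix.vecMul_vecMul,
      Matrix.nonsing_inv_mul _ ((Matrix.isUnit_iff_isUnit_det _).1 hM), Matrix.vecMul_one]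
  let K : Fin N → besselSubmodule := fun i => ⟨resolventKernel s (((i : ℕ) + 1 : ℕ) : ℝ),
    resolventKernel_mem_besselDomain hs (by positivity)⟩
  set B := besselBilin (s ^ 2 / 2)
  have hBK : ∀ (v : besselSubmodule) i, B v (K i) = (v : ℝ → ℝ) (((i : ℕ) + 1 : ℕ) : ℝ) :=
    fun v i => besselForm_resolventKernel hs (by positivity) v.2
  let w : besselSubmodule := ∑ i, c i • K i
  have hBw : ∀ v : besselSubmodule, B v w = ∑ i, c i * (v : ℝ → ℝ) (((i : ℕ) + 1 : ℕ) : ℝ) := by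
    intro v
    rw [map_sum]
    exact Finset.sum_congr rfl fun i _ => by rw [map_smul, hBK, smul_eq_mul]
  have hwval : ∀ j : Fin N, (w : ℝ → ℝ) (((j : ℕ) + 1 : ℕ) : ℝ) = evalVector f j := by
    intro j
    rw [← hcM, Matrix.vecMul, dotProduct]
    simp only [w, Submodule.coe_sum, Submodule.coe_smul, Finset.sum_apply, Pi.smul_apply,
      smul_eq_mul]
    rfl
  have hBcomm : ∀ u v : besselSubmodule, B u v = B v u := fun u v => besselForm_comm _ _ _
  have hw : IsRestriction (atomicMeasure N a) w f :=
    (isRestriction_atomicMeasure_iff ha).2 ⟨w.2, hwval⟩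
  have hwperp : (w : ℝ → ℝ) ∈ restrictionKernelPerp (atomicMeasure N a) (s ^ 2 / 2) := by
    refine ⟨w.2, fun v hv => ?_⟩
    obtain ⟨hv, hv0⟩ := (mem_restrictionKernel_atomicMeasure_iff ha).1 hv
    change B w ⟨v, hv⟩ = 0
    rw [hBcomm, hBw]
    exact Finset.sum_eq_zero fun i _ => mul_eq_zero_of_right _ (hv0 i)
  have hKperp : ∀ i, (K i : ℝ → ℝ) ∈ restrictionKernelPerp (atomicMeasure N a) (s ^ 2 / 2) := by
    refine fun i => ⟨(K i).2, fun v hv => ?_⟩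
    obtain ⟨hv, hv0⟩ := (mem_restrictionKernel_atomicMeasure_iff ha).1 hv
    change B (K i) ⟨v, hv⟩ = 0
    rw [hBcomm, hBK]
    exact hv0 i
  rw [approxTrace]
  refine le_antisymm ?_ (le_iInf fun u => le_iInf fun p => le_iInf fun h => ?_)
  · have hproj : IsProjection (atomicMeasure N a) (s ^ 2 / 2) w w := by
      refine ⟨hwperp, fun z hz => ?_⟩
      change B (w - w) ⟨z, hz.1⟩ = 0
      rw [sub_self, map_zero, LinearMap.zero_apply]
    refine (iInf₂_le (w : ℝ → ℝ) (w : ℝ → ℝ)).trans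
      ((iInf_le _ ⟨hw, hproj⟩).trans (le_of_eq ?_))
    change ENNReal.ofReal (B w w) = _
    rw [hBw, dotProduct]
    simp only [hwval]
  · obtain ⟨hu, hp, horth⟩ := h
    obtain ⟨hu, huf⟩ := (isRestriction_atomicMeasure_iff ha).1 hu
    let p' : besselSubmodule := ⟨p, hp.1⟩
    let u' : besselSubmodule := ⟨u, hu⟩
    have hpval : ∀ i : Fin N, p (((i : ℕ) + 1 : ℕ) : ℝ) = evalVector f i := by
      intro i
      have h1 : B (u' - p') (K i) = 0 := horth _ (hKperp i)
      rw [hBK] at h1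
      have h2 : u (((i : ℕ) + 1 : ℕ) : ℝ) - p (((i : ℕ) + 1 : ℕ) : ℝ) = 0 := h1
      rw [← huf i]
      linarith
    have hpw : B p' (p' - w) = 0 :=
      hp.2 _ ((mem_restrictionKernel_atomicMeasure_iff ha).2 ⟨(p' - w).2, fun i => by
        rw [Submodule.coe_sub, Pi.sub_apply, hwval, ← hpval i]
        exact sub_self _⟩)
    have hval : B p' p' = c ⬝ᵥ evalVector f := by
      rw [map_sub, sub_eq_zero, hBw] at hpw
      rw [hpw, dotProduct]
      exact Finset.sum_congr rfl fun i _ => by rw [← hpval i]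
    exact (congrArg ENNReal.ofReal hval).ge

/-! ### Passage to the limit and uniqueness of the Mosco limit -/

lemma tendsto_vecMul_inv_dotProduct (hN : 1 ≤ N) {s : ℕ → ℝ} (hs : Tendsto s atTop (𝓝[>] 0))
    {v : ℕ → Fin N → ℝ} {w : Fin N → ℝ} (hv : Tendsto v atTop (𝓝 w)) :
    Tendsto (fun n => Matrix.vecMul (v n) (resolventMatrix N (s n))⁻¹ ⬝ᵥ v n) atTop
      (𝓝 (Matrix.vecMul w (greenMatrix N)⁻¹ ⬝ᵥ w)) := by
  have hdet : (greenMatrix N).det ≠ 0 :=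
    ((Matrix.isUnit_iff_isUnit_det _).1 (isUnit_greenMatrix hN)).ne_zero
  have hinv : Tendsto (fun n => (resolventMatrix N (s n))⁻¹) atTop (𝓝 (greenMatrix N)⁻¹) := by
    have h := continuousAt_matrix_inv (greenMatrix N) (by
      rw [Ring.inverse_eq_inv']
      exact continuousAt_inv₀ hdet)
    have h' := h.tendsto.comp ((tendsto_resolventMatrix N).comp hs)
    simpa only [Function.comp_def] using h'
  have hcont : Continuous fun p : (Fin N → ℝ) × Matrix (Fin N) (Fin N) ℝ =>
      Matrix.vecMul p.1 p.2 ⬝ᵥ p.1 :=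
    (continuous_fst.matrix_vecMul continuous_snd).dotProduct continuous_fst
  have h := (hcont.tendsto (w, (greenMatrix N)⁻¹)).comp (hv.prodMk_nhds hinv)
  simpa only [Function.comp_def] using h

/-- Stronger than both Mosco conditions: the values converge along every weakly convergent sequence,
so constant sequences serve as recovery sequences. -/
lemma tendsto_approxTrace (ha : ∀ k ∈ Finset.Icc 1 N, 0 < a k) (hN : 1 ≤ N) {l : ℕ → ℝ}
    (hl : Tendsto l atTop (𝓝[>] 0)) {u : ℕ → Lp ℝ 2 (atomicMeasure N a)}
    {w : Lp ℝ 2 (atomicMeasure N a)}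
    (hu : ∀ v, Tendsto (fun n => inner ℝ (u n) v) atTop (𝓝 (inner ℝ w v))) :
    Tendsto (fun n => approxTrace (atomicMeasure N a) (l n) (u n)) atTop
      (𝓝 (traceForm N a w)) := by
  have hev : Tendsto (fun n => evalVector (u n)) atTop (𝓝 (evalVector w)) := by
    refine tendsto_pi_nhds.2 fun i => ?_
    have h := (hu (atomIndicator N a (i + 1))).const_mul (a (i + 1))⁻¹
    have hco : ∀ f : Lp ℝ 2 (atomicMeasure N a),
        (a (i + 1))⁻¹ * inner ℝ f (atomIndicator N a (i + 1)) = evalVector f i := by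
      intro f
      rw [evalVector_apply, ← coord_apply ha (fin_succ_mem_Icc i), real_inner_comm]
      rfl
    simpa only [hco] using h
  have hs : Tendsto (fun n => √(2 * l n)) atTop (𝓝[>] 0) := by
    refine tendsto_nhdsWithin_iff.2 ⟨?_, ?_⟩
    · have h : Continuous fun x : ℝ => √(2 * x) := by fun_prop
      have := (h.tendsto 0).comp (tendsto_nhdsWithin_iff.1 hl).1
      rwa [mul_zero, Real.sqrt_zero] at this
    · filter_upwards [(tendsto_nhdsWithin_iff.1 hl).2] with n hn
      exact Real.sqrt_pos.2 (mul_pos two_pos hn)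
  -- The determinants converge to that of the Green matrix, which is nonzero.
  have hunit : ∀ᶠ n in atTop, IsUnit (resolventMatrix N √(2 * l n)) := by
    have hdet : (greenMatrix N).det ≠ 0 :=
      ((Matrix.isUnit_iff_isUnit_det _).1 (isUnit_greenMatrix hN)).ne_zero
    have h := ((continuous_id.matrix_det.tendsto (greenMatrix N)).comp
      ((tendsto_resolventMatrix N).comp hs)).eventually_ne hdet
    filter_upwards [h] with n hn
    exact (Matrix.isUnit_iff_isUnit_det _).2 (isUnit_iff_ne_zero.2 hn)
  have hlim := ENNReal.tendsto_ofReal (tendsto_vecMul_inv_dotProduct hN hs hev)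
  rw [vecMul_inv_greenMatrix_dotProduct hN, ← traceForm_eq ha hN] at hlim
  refine hlim.congr' ?_
  filter_upwards [hunit, (tendsto_nhdsWithin_iff.1 hl).2] with n hn hln
  have hln : 0 < l n := hln
  rw [← approxTrace_atomicMeasure ha (Real.sqrt_pos.2 (by positivity)) hn,
    Real.sq_sqrt (by positivity), mul_div_cancel_left₀ _ two_ne_zero]

lemma isBesselTrace_traceForm (ha : ∀ k ∈ Finset.Icc 1 N, 0 < a k) (hN : 1 ≤ N) :
    IsBesselTrace (atomicMeasure N a) (traceForm N a) := fun _ hl =>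
  ⟨fun _ _ hu => (tendsto_approxTrace ha hN hl hu).liminf_eq.ge,
    fun w => ⟨fun _ => w, tendsto_const_nhds,
      (tendsto_approxTrace ha hN hl fun _ => tendsto_const_nhds).limsup_eq.le⟩⟩

/-- A recovery sequence for `E'` converges strongly, hence weakly, and is admissible in the lower
bound for `E`. -/
lemma IsMoscoLimit.le {H : Type*} [NormedAddCommGroup H] [InnerProductSpace ℝ H]
    {q : ℝ → H → ℝ≥0∞} {E E' : H → ℝ≥0∞} (h : IsMoscoLimit q E) (h' : IsMoscoLimit q E') (w : H) :
    E w ≤ E' w := by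
  obtain ⟨l, -, hl, hl0⟩ := exists_seq_strictAnti_tendsto (0 : ℝ)
  have hl' : Tendsto l atTop (𝓝[>] 0) :=
    tendsto_nhdsWithin_iff.2 ⟨hl0, Eventually.of_forall hl⟩
  obtain ⟨u, hu, hle⟩ := (h' l hl').2 w
  exact ((h l hl').1 u w fun v => hu.inner tendsto_const_nhds).trans
    ((liminf_le_limsup (by isBoundedDefault) (by isBoundedDefault)).trans hle)

lemma IsMoscoLimit.unique {H : Type*} [NormedAddCommGroup H] [InnerProductSpace ℝ H]
    {q : ℝ → H → ℝ≥0∞} {E E' : H → ℝ≥0∞} (h : IsMoscoLimit q E) (h' : IsMoscoLimit q E') :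
    E = E' :=
  funext fun w => le_antisymm (h.le h' w) (h'.le h w)

end Trace

end

theorem mainTheorem8 (N : ℕ) (hN : 1 ≤ N) (a : ℕ → ℝ) (ha : ∀ k ∈ Finset.Icc 1 N, 0 < a k) :
    ∃ E : Lp ℝ 2 (atomicMeasure N a) → ℝ≥0∞,
      -- `E` is the trace form; it is unique, and a Dirichlet form
      IsBesselTrace (atomicMeasure N a) E ∧
      (∀ E' : Lp ℝ 2 (atomicMeasure N a) → ℝ≥0∞,
        IsBesselTrace (atomicMeasure N a) E' → E' = E) ∧
      IsDirichletForm E ∧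
      -- its domain is all of `L²(μ) = ℝ^N`
      formDomain E = Set.univ ∧
      Function.Bijective (evalVector : Lp ℝ 2 (atomicMeasure N a) → Fin N → ℝ) ∧
      -- the explicit formula
      (∀ u : Lp ℝ 2 (atomicMeasure N a),
        E u = ENNReal.ofReal
          ((∑ k ∈ Finset.Ico 1 N, (k : ℝ) * ((k : ℝ) + 1) * (u ((k : ℝ) + 1) - u (k : ℝ)) ^ 2) +
            (N : ℝ) * u (N : ℝ) ^ 2)) ∧
      -- decomposition into a jump and a killing Dirichlet form
      (∀ u : Lp ℝ 2 (atomicMeasure N a),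
        E u = atomicJumpForm besselJumpRate u + atomicKillingForm (besselKillingRate N) u) ∧
      IsDirichletForm
        (atomicJumpForm besselJumpRate : Lp ℝ 2 (atomicMeasure N a) → ℝ≥0∞) ∧
      IsDirichletForm
        (atomicKillingForm (besselKillingRate N) : Lp ℝ 2 (atomicMeasure N a) → ℝ≥0∞) ∧
      -- transience, irreducibility, and failure of conservativeness
      IsTransientForm E ∧
      (∃ T : ℝ → Lp ℝ 2 (atomicMeasure N a) →L[ℝ] Lp ℝ 2 (atomicMeasure N a),
        IsFormSemigroup E T) ∧
      ∀ T : ℝ → Lp ℝ 2 (atomicMeasure N a) →L[ℝ] Lp ℝ 2 (atomicMeasure N a),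
        IsFormSemigroup E T →
          IsTransientSemigroup T ∧ IsIrreducibleSemigroup T ∧ ¬ IsConservativeSemigroup T := by
  refine ⟨traceForm N a, isBesselTrace_traceForm ha hN,
    fun E' hE' => IsMoscoLimit.unique hE' (isBesselTrace_traceForm ha hN),
    isDirichletForm_traceForm ha hN, formDomain_squareForm, bijective_evalVector ha, fun u => ?_,
    traceForm_eq_add ha hN, isDirichletForm_atomicJumpForm ha besselJumpRate_nonneg,
    isDirichletForm_atomicKillingForm ha besselKillingRate_nonneg, isTransientForm_traceForm ha hN,
    ⟨_, isFormSemigroup_traceForm ha hN⟩, fun T hT =>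
      ⟨isTransientSemigroup_of_traceForm ha hN hT, isIrreducibleSemigroup_of_traceForm ha hT,
        not_isConservativeSemigroup_of_traceForm ha hN hT⟩⟩
  rw [traceForm_eq ha hN, traceEnergy]
  push_cast
  rfl
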